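/- **Theorem (learning from cost).** *Setting.* Let $\mathcal X,\mathcal Y$ be countable sets, let $\rho$ be a probability distribution on $\mathcal X$, let $\pi_{\mathrm{ref}}:\mathcal X\to\Delta(\mathcal Y)$ be a reference policy, let $q:\mathcal X\times\mathcal Y\to\Delta(\mathcal Y)$ be a user edit distribution, and let $\Delta_{\mathrm{edit}}:\mathcal Y\times\mathcal Y\to[0,c_{\max}]$ with $c_{\max}>0$. Write $c(x,y)=\mathbb E_{y'\sim q(\cdot\mid x,y)}[\Delta_{\mathrm{edit}}(y,y')]$. Let $\beta>0$, $\delta\in(0,1)$ and $n\ge 1$. For a bounded function $f:\mathcal X\times\mathcal Y\to\mathbb R$ and a policy $\pi:\mathcal X\to\Delta(\mathcal Y)$ put $$J_\beta(\pi,f,x)=\mathbb E_{y\sim\pi(\cdot\mid x)}\Big[f(x,y)+\beta\log\tfrac{\pi(y\mid x)}{\pi_{\mathrm{ref}}(y\mid x)}\Big],\qquad J_\beta(\pi,f)=\mathbb E_{x\sim\rho}[J_\beta(\pi,f,x)],\qquad J_\beta(\pi)=J_\beta(\pi,c),$$ with values in $(-\infty,+\infty]$; the expectation of the logarithm is the Kullback–Leibler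 divergence. Let $\pi_\star^{f,\beta}$ denote a minimizer of $J_\beta(\cdot,f)$ over all policies (it is unique on the support of $\rho$). *Data.* $D=\{(x_i,y_i,y_i')\}_{i=1}^n$ consists of independent records with $x_i\sim\rho$, $y_i\sim\pi_{\mathrm{ref}}(\cdot\mid x_i)$, $y_i'\sim q(\cdot\mid x_i,y_i)$, and $c_i=\Delta_{\mathrm{edit}}(y_i,y_i')$. Fresh contexts $\bar x_1,\dots,\bar x_n\sim\rho$ are independent of each other and of $D$. *Algorithm.* Let $\mathcal F$ be a finite set of functions $\mathcal X\times\mathcal Y\to[-c_{\max},c_{\max}]$ with $c\in\mathcal F$, and let $\Pi$ be a finite set of policies. Let $\hat f\in\arg\min_{f\in\mathcal F}\frac1n\sum_{i=1}^n(f(x_i,y_i)-c_i)^2$ and, for a constant $b\ge1$, $$\hat{\mathcal F}=\Big\{f\in\mathcal F:\ \sum_{i=1}^n\big(f(x_i,y_i)-\hat f(x_i,y_i)\big)^2\le b\,c_{\max}^2\log\tfrac{|\mathcal F|}{\delta}\Big\},\qquad \bar f(x,y)=\max_{f\in\hat{\mathcal F}}f(x,y),$$ $$\Pi(\bar f)=\big\{\pi\in\Pi:\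 |J_\beta(\pi,\bar f,x)|\le c_{\max}\ \text{ for all }x\in\operatorname{supp}\rho\big\},\qquad \hat\pi_{\mathrm{RL}}\in\arg\min_{\pi\in\Pi(\bar f)}\sum_{i=1}^nJ_\beta(\pi,\bar f,\bar x_i).$$ Assume that $\pi_\star^{c,\beta}\in\Pi$ and that, almost surely, $\Pi$ contains an optimal policy $\pi_\star^{\bar f,\beta}$ for the pessimistic cost $\bar f$. *Eluder dimension.* For a class $\mathcal G$ of real functions on $\mathcal Z$ and $\epsilon>0$, a point $z$ is $\epsilon$-dependent on $z_1,\dots,z_m$ if all $g,g'\in\mathcal G$ with $\sqrt{\sum_{i\le m}(g(z_i)-g'(z_i))^2}\le\epsilon$ satisfy $g(z)-g'(z)\le\epsilon$, and $\epsilon$-independent otherwise. Let $\bar d(\mathcal G,\epsilon)$ be the length of the longest sequence in $\mathcal Z$ in which every element is $\epsilon$-independent of its predecessors, and $d_{\mathrm{eluder}}(\mathcal G,\epsilon)=\sup_{\epsilon'\ge\epsilon}\bar d(\mathcal G,\epsilon')$. *Claim.* There is a universal constant $b_0\ge1$ such that for every $b\ge b_0$ there is a constant $K>0$, depending only on $b$,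 such that in every setting as above, with probability at least $1-\delta$ over $(D,\bar x_1,\dots,\bar x_n)$, every such minimizer $\hat\pi_{\mathrm{RL}}$ satisfies $$J_\beta(\hat\pi_{\mathrm{RL}})\le J_\beta(\pi_\star^{c,\beta})+K\,c_{\max}\left(\sqrt{\frac{\log(|\Pi|/\delta)}{n}}+\bar C_\star\sqrt{\frac{\log(n)\,d_{\mathrm{eluder}}(\mathcal F,c_{\max}/n)\,\log(|\mathcal F|/\delta)}{n}}\right),$$ where $\bar C_\star=\sqrt{\mathbb E_{x\sim\rho,\,y\sim\pi_{\mathrm{ref}}(\cdot\mid x)}\Big[\Big(\frac{\pi_\star^{c,\beta}(y\mid x)}{\pi_{\mathrm{ref}}(y\mid x)}\Big)^2\Big]}$. -/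

import Mathlib

open MeasureTheory
open scoped ENNReal

noncomputable section

namespace UserEdits

/-! ### Eluder dimension -/

/-- `z` is `ε`-dependent on the finite sequence `w` with respect to the function class `G`. -/
def EpsDependent {Z : Type*} (G : Set (Z → ℝ)) (ε : ℝ) {m : ℕ} (w : Fin m → Z) (z : Z) : Prop :=
  ∀ g ∈ G, ∀ g' ∈ G, √(∑ i, (g (w i) - g' (w i)) ^ 2) ≤ ε → g z - g' z ≤ ε

/-- Every element of the sequence `z` is `ε`-independent of its predecessors. -/
def IsEluderSeq {Z : Type*} (G : Set (Z → ℝ)) (ε : ℝ) {m : ℕ} (z : Fin m → Z) : Prop :=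
  ∀ k : Fin m, ¬ EpsDependent G ε (fun i : Fin (k : ℕ) => z (Fin.castLE k.isLt.le i)) (z k)

/-- The non-monotone `ε`-eluder dimension: the length of the longest sequence all of whose
elements are `ε`-independent of their predecessors. -/
def nonMonotoneEluderDim {Z : Type*} (G : Set (Z → ℝ)) (ε : ℝ) : ℕ∞ :=
  ⨆ (m : ℕ) (_ : ∃ z : Fin m → Z, IsEluderSeq G ε z), (m : ℕ∞)

/-- The `ε`-eluder dimension: the largest non-monotone `ε'`-eluder dimension, `ε' ≥ ε`. -/
def eluderDim {Z : Type*} (G : Set (Z → ℝ)) (ε : ℝ) : ℕ∞ :=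
  ⨆ (ε' : ℝ) (_ : ε ≤ ε'), nonMonotoneEluderDim G ε'

theorem IsEluderSeq.length_le {Z : Type*} (F : Finset (Z → ℝ)) {ε : ℝ} (hε : 0 ≤ ε) {m : ℕ}
    {z : Fin m → Z} (hz : IsEluderSeq (F : Set (Z → ℝ)) ε z) : m ≤ F.card * F.card := by
  classical
  unfold IsEluderSeq EpsDependent at hz
  push Not at hz
  choose g hg g' hg' hs hlt using hz
  have hinj : Function.Injective (fun k => (g k, g' k)) := by
    have key : ∀ j k : Fin m, j < k → g j = g k → g' j = g' k → False := by
      intro j k hjk h1 h2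
      have hj := hlt j
      rw [h1, h2] at hj
      have h3 := Real.sqrt_le_left hε |>.mp (hs k)
      have h4 := Finset.single_le_sum
        (f := fun i : Fin (k : ℕ) => (g k (z (Fin.castLE k.isLt.le i))
          - g' k (z (Fin.castLE k.isLt.le i))) ^ 2)
        (fun i _ => sq_nonneg _) (Finset.mem_univ (⟨j, hjk⟩ : Fin (k : ℕ)))
      have h5 : Fin.castLE k.isLt.le (⟨j, hjk⟩ : Fin (k : ℕ)) = j := rfl
      simp only [h5] at h4
      nlinarith
    intro j k h
    have h1 := congrArg Prod.fst h
    have h2 := congrArg Prod.snd h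
    rcases lt_trichotomy j k with hjk | hjk | hjk
    · exact (key j k hjk h1 h2).elim
    · exact hjk
    · exact (key k j hjk h1.symm h2.symm).elim
  have := Finset.card_le_card_of_injOn (s := Finset.univ) (t := F ×ˢ F)
    (fun k => (g k, g' k)) (fun k _ => by simpa using ⟨hg k, hg' k⟩) hinj.injOn
  simpa using this

/-- A finite class has finite eluder dimension, so its value may be read as a natural number. -/
theorem eluderDim_ne_top {Z : Type*} (F : Finset (Z → ℝ)) {ε : ℝ} (hε : 0 ≤ ε) :
    eluderDim (F : Set (Z → ℝ)) ε ≠ ⊤ := by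
  have h : eluderDim (F : Set (Z → ℝ)) ε ≤ ((F.card * F.card : ℕ) : ℕ∞) := by
    refine iSup₂_le fun ε' hε' => iSup₂_le ?_
    rintro m ⟨z, hz⟩
    exact_mod_cast hz.length_le F (hε.trans hε')
  exact ne_top_of_le_ne_top (ENat.natCast_ne_top _) h

/-! ### Policies and the regularized objective -/

/-- A policy assigns to each context a distribution over responses. -/
abbrev Policy (X Y : Type*) := X → PMF Y

/-- The expected edit cost `c(x, y) = E_{y' ∼ q(⋅ | x, y)} [Δ(y, y')]`. -/
def expectedCost {X Y : Type*} [MeasurableSpace Y] (q : X → Y → PMF Y) (Δ : Y → Y → ℝ) :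
    X × Y → ℝ :=
  fun z => ∫ y', Δ z.2 y' ∂(q z.1 z.2).toMeasure

/-- The regularized cost at the context `x`, that is,
`E_{y ∼ π(⋅ | x)} [f(x, y) + β log (π(y | x) / πref(y | x))]`, for bounded `f`. The expectation of
the logarithm is the Kullback–Leibler divergence, which may be `+∞`. -/
def regCostAt {X Y : Type*} [MeasurableSpace Y] (πref : Policy X Y) (β : ℝ) (f : X × Y → ℝ)
    (π : Policy X Y) (x : X) : EReal :=
  ((∫ y, f (x, y) ∂(π x).toMeasure : ℝ) : EReal) +
    ((ENNReal.ofReal β * InformationTheory.klDiv (π x).toMeasure (πref x).toMeasure : ℝ≥0∞) : EReal)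

/-- The regularized objective
`E_{x ∼ ρ, y ∼ π(⋅ | x)} [f(x, y) + β log (π(y | x) / πref(y | x))]`, for bounded `f`. -/
def regObjective {X Y : Type*} [MeasurableSpace X] [MeasurableSpace Y] (ρ : PMF X)
    (πref : Policy X Y) (β : ℝ) (f : X × Y → ℝ) (π : Policy X Y) : EReal :=
  ((∫ x, ∫ y, f (x, y) ∂(π x).toMeasure ∂ρ.toMeasure : ℝ) : EReal) +
    ((ENNReal.ofReal β *
      ∫⁻ x, InformationTheory.klDiv (π x).toMeasure (πref x).toMeasure ∂ρ.toMeasure : ℝ≥0∞) : EReal)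

/-- `π` is an optimal policy of the regularized objective with cost `f`, among all policies. -/
def IsRegOptimal {X Y : Type*} [MeasurableSpace X] [MeasurableSpace Y] (ρ : PMF X)
    (πref : Policy X Y) (β : ℝ) (f : X × Y → ℝ) (π : Policy X Y) : Prop :=
  ∀ π' : Policy X Y, regObjective ρ πref β f π ≤ regObjective ρ πref β f π'

/-- The concentrability coefficient `√(E_{x ∼ ρ, y ∼ πref(⋅ | x)} [(π(y | x) / πref(y | x))²])`. -/
def concentrability {X Y : Type*} [MeasurableSpace X] [MeasurableSpace Y] (ρ : PMF X)
    (πref π : Policy X Y) : ℝ≥0∞ :=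
  (∫⁻ x, ∫⁻ y, (π x y / πref x y) ^ 2 ∂(πref x).toMeasure ∂ρ.toMeasure) ^ (1 / 2 : ℝ)

/-! ### The data -/

/-- The law of one record `(x, y, y')` with `x ∼ ρ`, `y ∼ πref(⋅ | x)`, `y' ∼ q(⋅ | x, y)`. -/
def editLaw {X Y : Type*} (ρ : PMF X) (πref : Policy X Y) (q : X → Y → PMF Y) : PMF (X × Y × Y) :=
  ρ.bind fun x => (πref x).bind fun y => (q x y).map fun y' => (x, y, y')

/-- The law of the offline data set: `n` independent records. -/
def offlineLaw {X Y : Type*} [MeasurableSpace X] [MeasurableSpace Y] (n : ℕ) (ρ : PMF X)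
    (πref : Policy X Y) (q : X → Y → PMF Y) : Measure (Fin n → X × Y × Y) :=
  Measure.pi fun _ => (editLaw ρ πref q).toMeasure

/-- The joint law of the offline data set and of `n` fresh contexts, all independent. -/
def sampleLaw {X Y : Type*} [MeasurableSpace X] [MeasurableSpace Y] (n : ℕ) (ρ : PMF X)
    (πref : Policy X Y) (q : X → Y → PMF Y) : Measure ((Fin n → X × Y × Y) × (Fin n → X)) :=
  (offlineLaw n ρ πref q).prod (Measure.pi fun _ => ρ.toMeasure)

/-! ### The algorithm -/

/-- The squared loss of the cost model `f` on the observed costs `Δ(yᵢ, yᵢ')`. -/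
def squaredLoss {X Y : Type*} {n : ℕ} (Δ : Y → Y → ℝ) (D : Fin n → X × Y × Y) (f : X × Y → ℝ) : ℝ :=
  (1 / n : ℝ) * ∑ i, (f ((D i).1, (D i).2.1) - Δ (D i).2.1 (D i).2.2) ^ 2

/-- `fhat` minimizes the squared loss over the class `F`. -/
def IsLeastSquares {X Y : Type*} {n : ℕ} (F : Finset (X × Y → ℝ)) (Δ : Y → Y → ℝ)
    (D : Fin n → X × Y × Y) (fhat : X × Y → ℝ) : Prop :=
  fhat ∈ F ∧ ∀ f ∈ F, squaredLoss Δ D fhat ≤ squaredLoss Δ D f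

/-- The confidence set of cost functions with squared radius `r`, centred at `fhat`. -/
def confidenceSet {X Y : Type*} {n : ℕ} (F : Finset (X × Y → ℝ)) (r : ℝ) (D : Fin n → X × Y × Y)
    (fhat : X × Y → ℝ) : Set (X × Y → ℝ) :=
  {f | f ∈ F ∧ ∑ i, (f ((D i).1, (D i).2.1) - fhat ((D i).1, (D i).2.1)) ^ 2 ≤ r}

/-- The pessimistic cost: the pointwise maximum over the confidence set (a finite set, which
contains `fhat` when `fhat ∈ F` and `0 ≤ r`). -/
def pessimisticCost {X Y : Type*} {n : ℕ} (F : Finset (X × Y → ℝ)) (r : ℝ) (D : Fin n → X × Y × Y)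
    (fhat : X × Y → ℝ) : X × Y → ℝ :=
  fun z => sSup ((fun f : X × Y → ℝ => f z) '' confidenceSet F r D fhat)

/-- The policies whose regularized cost for `f` lies in `[-cmax, cmax]` at every context in the
support of `ρ`. -/
def boundedPolicies {X Y : Type*} [MeasurableSpace Y] (ρ : PMF X) (πref : Policy X Y) (β cmax : ℝ)
    (f : X × Y → ℝ) : Set (Policy X Y) :=
  {π | ∀ x ∈ ρ.support, ((-cmax : ℝ) : EReal) ≤ regCostAt πref β f π x ∧
    regCostAt πref β f π x ≤ ((cmax : ℝ) : EReal)}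

/-- `πhat` minimizes the empirical regularized cost for `f` on the contexts `xbar`, over the
policies of the class `P` with bounded regularized cost. -/
def IsRLPolicy {X Y : Type*} [MeasurableSpace Y] {n : ℕ} (ρ : PMF X) (πref : Policy X Y)
    (β cmax : ℝ) (P : Finset (Policy X Y)) (f : X × Y → ℝ) (xbar : Fin n → X)
    (πhat : Policy X Y) : Prop :=
  (πhat ∈ P ∧ πhat ∈ boundedPolicies ρ πref β cmax f) ∧
    ∀ π ∈ P, π ∈ boundedPolicies ρ πref β cmax f →
      ∑ i, regCostAt πref β f πhat (xbar i) ≤ ∑ i, regCostAt πref β f π (xbar i)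

end UserEdits

end

noncomputable section

namespace UserEdits

/-! ### Counting large widths with the eluder dimension -/

/-! Pessimism confines the estimation error to the comparator. Suppose `c ≤ fbar ≤ c + W`, and let
`π₀` be optimal for `fbar`. Then `J(πhat, c) ≤ J(πhat, fbar) ≤ J(π₀, fbar) + η ≤ J(πstar, fbar) + η
≤ J(πstar, c) + E_πstar[W] + η`, where `η` is the sampling error over the fresh contexts
(`regObjective_le_add_width`). The width is averaged only under `πstar`, so no coverage of `πhat` is
needed.

The error `η` comes from Hoeffding's inequality and a union bound over the policy class
(`pi_isRLPolicy_le`). For a fixed data set, `fbar` is a fixed function and the contexts are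
independent of it. Optimal policies satisfy the cost bound at each context of the support, so `π₀`
competes in the empirical minimization.

For the width, changing measure and applying Cauchy–Schwarz bound `E_πstar[W]` by the
concentrability times `√(E_πref[W²])` (`IsRegOptimal.lintegral_le_concentrability_mul`). Least
squares puts `c` in the confidence set and keeps that set inside a ball around `c` in population
squared distance (`offlineLaw_pessimism_le`). The width `W` of that ball does not depend on the
data, so a single deviation bound passes from `E_πref[W²]` to the sum of `W²` on the sample. The
eluder dimension controls this sum: few sample points can have a large width over functions that are
close on the whole sample (`card_width_gt_le`). Adding up dyadic scales costs a factor `log n`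
(`sum_sq_width_le`). -/

/-- Every element of the list is `ε`-independent of the elements behind it. -/
def IsEluderList {Z : Type*} (G : Set (Z → ℝ)) (ε : ℝ) : List Z → Prop
  | [] => True
  | z :: w => (∃ g ∈ G, ∃ g' ∈ G, (w.map fun u => (g u - g' u) ^ 2).sum ≤ ε ^ 2 ∧
      ε < g z - g' z) ∧ IsEluderList G ε w

/-- A list carries its latest point at the head, so the induction appends the head at the end of the
sequence. The identity of sums is carried along to turn the list condition on squared distances into
the condition on the sequence. -/
theorem IsEluderList.exists_isEluderSeq {Z : Type*} {G : Set (Z → ℝ)} {ε : ℝ} (hε : 0 ≤ ε) :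
    ∀ w : List Z, IsEluderList G ε w → ∃ z : Fin w.length → Z, IsEluderSeq G ε z ∧
      ∀ φ : Z → ℝ, ∑ i, φ (z i) = (w.map φ).sum
  | [], _ => ⟨Fin.elim0, fun k => k.elim0, fun φ => by simp⟩
  | a :: w, ⟨⟨g, hg, g', hg', hs, hlt⟩, hw⟩ => by
    obtain ⟨z, hz, hsum⟩ := IsEluderList.exists_isEluderSeq hε w hw
    refine ⟨Fin.snoc (α := fun _ => Z) z a, ?_, fun φ => ?_⟩
    · intro k
      induction k using Fin.lastCases with
      | last =>
        intro hdep
        have h := hdep g hg g' hg' ?_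
        · simp only [Fin.snoc_last] at h
          linarith
        · refine (Real.sqrt_le_left hε).mpr (le_trans (le_of_eq ?_) hs)
          rw [← hsum]
          refine Finset.sum_congr rfl fun i _ => ?_
          have : Fin.castLE (Fin.last w.length).isLt.le i = Fin.castSucc i := rfl
          beta_reduce
          rw [this, Fin.snoc_castSucc]
      | cast k =>
        have h := hz k
        unfold EpsDependent at h ⊢
        simp only [Fin.snoc_castSucc]
        have e : ∀ i : Fin (k.castSucc : ℕ),
            Fin.snoc (α := fun _ => Z) z a (Fin.castLE k.castSucc.isLt.le i)
              = z (Fin.castLE k.isLt.le i) := by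
          intro i
          have : Fin.castLE k.castSucc.isLt.le i = Fin.castSucc (Fin.castLE k.isLt.le i) := rfl
          rw [this, Fin.snoc_castSucc]
        simp only [e]
        exact h
    · simp only [List.length_cons, Fin.sum_univ_castSucc, Fin.snoc_castSucc, Fin.snoc_last, hsum,
        List.map_cons, List.sum_cons]
      ring

theorem IsEluderList.length_le {Z : Type*} {F : Finset (Z → ℝ)} {ε₀ ε : ℝ} (hε₀ : 0 ≤ ε₀)
    (hε : ε₀ ≤ ε) {w : List Z} (hw : IsEluderList (F : Set (Z → ℝ)) ε w) :
    w.length ≤ (eluderDim (F : Set (Z → ℝ)) ε₀).toNat := by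
  obtain ⟨z, hz, -⟩ := hw.exists_isEluderSeq (hε₀.trans hε)
  have h1 : (w.length : ℕ∞) ≤ nonMonotoneEluderDim (F : Set (Z → ℝ)) ε :=
    le_iSup₂_of_le (f := fun (m : ℕ) (_ : ∃ z : Fin m → Z, IsEluderSeq (F : Set (Z → ℝ)) ε z) =>
      (m : ℕ∞)) w.length ⟨z, hz⟩ le_rfl
  have h2 : nonMonotoneEluderDim (F : Set (Z → ℝ)) ε ≤ eluderDim (F : Set (Z → ℝ)) ε₀ :=
    le_iSup₂_of_le (f := fun (ε' : ℝ) (_ : ε₀ ≤ ε') =>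
      nonMonotoneEluderDim (F : Set (Z → ℝ)) ε') ε hε le_rfl
  have h3 := ENat.toNat_le_toNat (h1.trans h2) (eluderDim_ne_top F hε₀)
  simpa using h3

/-- Greedy filling of `K` bins. The witnesses `g, g'` of a new point have total squared distance at
most `R < K ε²` on the earlier points, so on some bin it is at most `ε²`. The new point is
independent of that bin and joins it. -/
theorem exists_eluderList_partition {Z : Type*} {G : Set (Z → ℝ)} {ε R : ℝ} {K : ℕ}
    (hK : R < K * ε ^ 2) (l : List Z)
    (hl : ∀ z ∈ l, ∃ g ∈ G, ∃ g' ∈ G, (l.map fun u => (g u - g' u) ^ 2).sum ≤ R ∧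
      ε < g z - g' z) :
    ∃ B : Fin K → List Z, (∀ k, IsEluderList G ε (B k)) ∧ ∑ k, (B k).length = l.length ∧
      ∀ φ : Z → ℝ, ∑ k, ((B k).map φ).sum = (l.map φ).sum := by
  classical
  induction l with
  | nil => exact ⟨fun _ => [], fun _ => trivial, by simp, by simp⟩
  | cons z l ih =>
    obtain ⟨B, hB, hlen, hsum⟩ := ih fun u hu => by
      obtain ⟨g, hg, g', hg', hs, hlt⟩ := hl u (List.mem_cons_of_mem _ hu)
      refine ⟨g, hg, g', hg', le_trans ?_ hs, hlt⟩
      simp only [List.map_cons, List.sum_cons]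
      linarith [sq_nonneg (g z - g' z)]
    obtain ⟨g, hg, g', hg', hs, hlt⟩ := hl z List.mem_cons_self
    have hk : ∃ k, ((B k).map fun u => (g u - g' u) ^ 2).sum ≤ ε ^ 2 := by
      by_contra! hcon
      have h1 : ∑ _k : Fin K, ε ^ 2 ≤ ∑ k, ((B k).map fun u => (g u - g' u) ^ 2).sum :=
        Finset.sum_le_sum fun k _ => (hcon k).le
      rw [hsum] at h1
      simp only [Finset.sum_const, Finset.card_univ, Fintype.card_fin, nsmul_eq_mul] at h1
      simp only [List.map_cons, List.sum_cons] at hs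
      linarith [sq_nonneg (g z - g' z)]
    obtain ⟨k, hk⟩ := hk
    have hupd : ∀ {M : Type} [AddCommMonoid M] (ψ : List Z → M) (c : M),
        ψ (z :: B k) = c + ψ (B k) →
        ∑ j, ψ (Function.update B k (z :: B k) j) = c + ∑ j, ψ (B j) := by
      intro M _ ψ c h
      rw [← Finset.add_sum_erase _ _ (Finset.mem_univ k),
        ← Finset.add_sum_erase _ (fun j => ψ (B j)) (Finset.mem_univ k), ← add_assoc]
      congr 1
      · simpa using h
      · refine Finset.sum_congr rfl fun j hj => ?_
        rw [Function.update_of_ne (Finset.ne_of_mem_erase hj)]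
    refine ⟨Function.update B k (z :: B k), fun j => ?_, ?_, fun φ => ?_⟩
    · rcases eq_or_ne j k with rfl | hj
      · rw [Function.update_self]
        exact ⟨⟨g, hg, g', hg', hk, hlt⟩, hB j⟩
      · rw [Function.update_of_ne hj]
        exact hB j
    · rw [hupd List.length 1 (by simp [add_comm]), hlen]
      simp [add_comm]
    · rw [hupd (fun w => (w.map φ).sum) (φ z) (by simp), hsum]
      simp

/-- At most `(R / ε² + 1) d` points of a sequence have width larger than `ε` over the pairs of
functions whose squared distance on the sequence is at most `R`. -/
theorem card_width_gt_le {Z : Type*} {F : Finset (Z → ℝ)} {ε₀ ε R : ℝ} (hε₀ : 0 < ε₀)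
    (hε : ε₀ ≤ ε) (hR : 0 ≤ R) {n : ℕ} (z : Fin n → Z) (S : Finset (Fin n))
    (hS : ∀ i ∈ S, ∃ g ∈ F, ∃ g' ∈ F, ∑ j, (g (z j) - g' (z j)) ^ 2 ≤ R ∧
      ε < g (z i) - g' (z i)) :
    (S.card : ℝ) ≤ (R / ε ^ 2 + 1) * (eluderDim (F : Set (Z → ℝ)) ε₀).toNat := by
  have hpos : 0 < ε ^ 2 := by have := hε₀.trans_le hε; positivity
  -- The least number of bins with `R < K ε²`; each bin then holds at most `d` points.
  set K : ℕ := ⌊R / ε ^ 2⌋₊ + 1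
  have hK : R < K * ε ^ 2 := by
    rw [← div_lt_iff₀ hpos]
    simpa [K] using Nat.lt_floor_add_one (R / ε ^ 2)
  obtain ⟨B, hB, hlen, -⟩ := exists_eluderList_partition (G := (F : Set (Z → ℝ))) hK
    (S.toList.map z) (by
      intro u hu
      obtain ⟨i, hi, rfl⟩ := List.mem_map.mp hu
      obtain ⟨g, hg, g', hg', hs, hlt⟩ := hS i (Finset.mem_toList.mp hi)
      refine ⟨g, hg, g', hg', le_trans ?_ hs, hlt⟩
      rw [List.map_map]
      exact (Finset.sum_map_toList S (fun j => (g (z j) - g' (z j)) ^ 2)).trans_le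
        (Finset.sum_le_univ_sum_of_nonneg fun _ => sq_nonneg _))
  have h1 : S.card ≤ K * (eluderDim (F : Set (Z → ℝ)) ε₀).toNat := by
    have h := Finset.sum_le_sum fun k (_ : k ∈ Finset.univ) => (hB k).length_le hε₀.le hε
    rw [hlen] at h
    simpa using h
  have h2 : (K : ℝ) ≤ R / ε ^ 2 + 1 := by
    have := Nat.floor_le (div_nonneg hR hpos.le)
    push_cast [K]
    linarith
  calc (S.card : ℝ) ≤ ((K * (eluderDim (F : Set (Z → ℝ)) ε₀).toNat : ℕ) : ℝ) := by exact_mod_cast h1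
    _ = K * (eluderDim (F : Set (Z → ℝ)) ε₀).toNat := by push_cast; ring
    _ ≤ _ := by gcongr

/-- Layer cake: when `W` lies between `ε / 2 ^ (j + 1)` and `ε / 2 ^ j`, the `j`-th term alone
dominates `W²`; below all thresholds the remainder does. -/
theorem sq_le_dyadic {W ε : ℝ} (hW : 0 ≤ W) (hWε : W ≤ ε) (J : ℕ) :
    W ^ 2 ≤ (ε / 2 ^ J) ^ 2 +
      ∑ j ∈ Finset.range J, (ε / 2 ^ j) ^ 2 * (if ε / 2 ^ (j + 1) < W then 1 else 0) := by
  induction J with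
  | zero => simpa using pow_le_pow_left₀ hW hWε 2
  | succ J ih =>
    rw [Finset.sum_range_succ]
    by_cases h : ε / 2 ^ (J + 1) < W
    · rw [if_pos h]
      nlinarith [sq_nonneg (ε / 2 ^ (J + 1))]
    · have h0 : 0 ≤ ∑ j ∈ Finset.range J, (ε / 2 ^ j) ^ 2 *
          (if ε / 2 ^ (j + 1) < W then (1 : ℝ) else 0) :=
        Finset.sum_nonneg fun j _ => mul_nonneg (sq_nonneg _) (by split_ifs <;> norm_num)
      rw [if_neg h]
      have := pow_le_pow_left₀ hW (not_lt.mp h) 2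
      linarith

/-- The sum of the squared widths over the pairs of functions that are close on the sequence. -/
theorem sum_sq_width_le {Z : Type*} {F : Finset (Z → ℝ)} {M R : ℝ} (hM : 0 < M) (hR : 0 ≤ R)
    {n : ℕ} (hn : 2 ≤ n) (z : Fin n → Z) (W : Z → ℝ) (hW0 : ∀ u, 0 ≤ W u) (hWM : ∀ u, W u ≤ 2 * M)
    (hW : ∀ u, ∀ ε : ℝ, 0 < ε → ε < W u →
      ∃ g ∈ F, ∃ g' ∈ F, ∑ j, (g (z j) - g' (z j)) ^ 2 ≤ R ∧ ε < g u - g' u) :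
    ∑ i, W (z i) ^ 2 ≤ 4 * M ^ 2 + 16 * (R + M ^ 2) *
      (Real.log n * (eluderDim (F : Set (Z → ℝ)) (M / n)).toNat) := by
  set d : ℝ := ((eluderDim (F : Set (Z → ℝ)) (M / n)).toNat : ℝ) with hd
  have hd0 : 0 ≤ d := Nat.cast_nonneg _
  have hn0 : (0 : ℝ) < n := by exact_mod_cast (by omega : 0 < n)
  have hn2 : (2 : ℝ) ≤ n := by exact_mod_cast hn
  -- Since `n < 2 ^ J ≤ 2 n`, every threshold used stays above `M / n`, where the eluder dimension
  -- applies, while the remainder `2 M / 2 ^ J` is below `2 M / n` and sums to at most `4 M²`.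
  set J : ℕ := Nat.log 2 (2 * n)
  have hJ1 : (2 : ℝ) ^ J ≤ 2 * n := by
    exact_mod_cast Nat.pow_log_le_self 2 (by omega : 2 * n ≠ 0)
  have hJ2 : (2 * n : ℝ) < 2 ^ (J + 1) := by
    exact_mod_cast Nat.lt_pow_succ_log_self (by norm_num : 1 < 2) (2 * n)
  have hlog2 : (1 / 2 : ℝ) ≤ Real.log 2 := by linarith [Real.log_two_gt_d9]
  have hlogn : Real.log 2 ≤ Real.log n := Real.log_le_log (by norm_num) hn2
  have hJlog : (J : ℝ) ≤ 4 * Real.log n := by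
    have h := Real.log_le_log (by positivity) hJ1
    rw [Real.log_pow, Real.log_mul (by norm_num) hn0.ne'] at h
    have : (J : ℝ) * (1 / 2) ≤ J * Real.log 2 := by gcongr
    linarith
  have hterm : ∀ j ∈ Finset.range J, ∑ i, (2 * M / 2 ^ j) ^ 2 *
      (if 2 * M / 2 ^ (j + 1) < W (z i) then (1 : ℝ) else 0) ≤ 4 * (R + M ^ 2) * d := by
    intro j hj
    have hjJ : j + 1 ≤ J := Finset.mem_range.mp hj
    have hpow : (2 : ℝ) ^ (j + 1) ≤ 2 * n :=
      (pow_le_pow_right₀ (by norm_num) hjJ).trans hJ1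
    have hεpos : 0 < 2 * M / 2 ^ (j + 1) := by positivity
    have hε : M / n ≤ 2 * M / 2 ^ (j + 1) := by
      rw [div_le_div_iff₀ hn0 (by positivity)]
      nlinarith
    have hc := card_width_gt_le (F := F) (div_pos hM hn0) hε hR z
      (Finset.univ.filter fun i => 2 * M / 2 ^ (j + 1) < W (z i)) fun i hi =>
        hW _ _ hεpos (Finset.mem_filter.mp hi).2
    rw [← Finset.mul_sum, Finset.sum_boole]
    refine (mul_le_mul_of_nonneg_left hc (sq_nonneg _)).trans ?_
    rw [← hd, ← mul_assoc]
    refine mul_le_mul_of_nonneg_right ?_ hd0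
    -- The count grows like `1 / ε²` and the contribution of a point shrinks like `ε²`. Each level
    -- therefore costs the same up to a constant, and only the number of levels produces `log n`.
    have e1 : (2 * M / 2 ^ j) ^ 2 * (R / (2 * M / 2 ^ (j + 1)) ^ 2 + 1)
        = 4 * R + (2 * M / 2 ^ j) ^ 2 := by
      field_simp
      ring
    have e2 : 2 * M / 2 ^ j ≤ 2 * M := div_le_self (by positivity) (one_le_pow₀ (by norm_num))
    have e3 := pow_le_pow_left₀ (by positivity) e2 2
    rw [e1]
    linarith
  have hlast : (n : ℝ) * (2 * M / 2 ^ J) ^ 2 ≤ 4 * M ^ 2 := by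
    have h1 : 2 * M / 2 ^ J ≤ 2 * M / n := by
      apply div_le_div_of_nonneg_left (by positivity) hn0
      rw [pow_succ] at hJ2
      linarith
    have h2 := pow_le_pow_left₀ (by positivity) h1 2
    calc (n : ℝ) * (2 * M / 2 ^ J) ^ 2 ≤ n * (2 * M / n) ^ 2 := by gcongr
      _ = 4 * M ^ 2 / n := by field_simp; ring
      _ ≤ 4 * M ^ 2 := div_le_self (by positivity) (by linarith)
  calc ∑ i, W (z i) ^ 2
      ≤ ∑ i, ((2 * M / 2 ^ J) ^ 2 + ∑ j ∈ Finset.range J, (2 * M / 2 ^ j) ^ 2 *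
          (if 2 * M / 2 ^ (j + 1) < W (z i) then 1 else 0)) :=
        Finset.sum_le_sum fun i _ => sq_le_dyadic (hW0 _) (hWM _) J
    _ = n * (2 * M / 2 ^ J) ^ 2 + ∑ j ∈ Finset.range J, ∑ i, (2 * M / 2 ^ j) ^ 2 *
          (if 2 * M / 2 ^ (j + 1) < W (z i) then 1 else 0) := by
        rw [Finset.sum_add_distrib, Finset.sum_comm]
        simp
    _ ≤ 4 * M ^ 2 + ∑ _j ∈ Finset.range J, 4 * (R + M ^ 2) * d :=
        add_le_add hlast (Finset.sum_le_sum hterm)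
    _ = 4 * M ^ 2 + 4 * (R + M ^ 2) * d * J := by
        rw [Finset.sum_const, Finset.card_range, nsmul_eq_mul]
        ring
    _ ≤ 4 * M ^ 2 + 4 * (R + M ^ 2) * d * (4 * Real.log n) := by gcongr
    _ = _ := by ring

/-- If the eluder dimension vanishes, the functions of the class are uniformly close. -/
theorem sub_le_of_eluderDim_eq_zero {Z : Type*} {F : Finset (Z → ℝ)} {ε : ℝ} (hε : 0 ≤ ε)
    (hd : (eluderDim (F : Set (Z → ℝ)) ε).toNat = 0) {g g' : Z → ℝ} (hg : g ∈ F) (hg' : g' ∈ F)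
    (z : Z) : g z - g' z ≤ ε := by
  by_contra! hlt
  have h : IsEluderList (F : Set (Z → ℝ)) ε [z] :=
    ⟨⟨g, hg, g', hg', by simpa using sq_nonneg ε, hlt⟩, trivial⟩
  have := h.length_le hε le_rfl
  simp [hd] at this

/-! ### Deviation bounds for independent samples -/

section Deviation

variable {Z : Type*} [MeasurableSpace Z] {μ : Measure Z} [IsProbabilityMeasure μ]

/-- Markov's inequality for the product of the `exp (g (z i))`, whose mean is at most 1. The
deviation bounds below differ only in the choice of `g`. -/
theorem pi_le_sum_le_exp_neg {n : ℕ} {g : Z → ℝ} (hint : Integrable (fun z => Real.exp (g z)) μ)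
    (hg : ∫ z, Real.exp (g z) ∂μ ≤ 1) (t : ℝ) :
    Measure.pi (fun _ : Fin n => μ) {z | t ≤ ∑ i, g (z i)} ≤ ENNReal.ofReal (Real.exp (-t)) := by
  have hint' : Integrable (fun z : Fin n → Z => ∏ i, Real.exp (g (z i)))
      (Measure.pi fun _ : Fin n => μ) := Integrable.fintype_prod fun _ => hint
  have h := mul_meas_ge_le_integral_of_nonneg
    (Filter.Eventually.of_forall fun z => Finset.prod_nonneg fun i _ => (Real.exp_pos _).le) hint'
    (Real.exp t)
  rw [integral_fintype_prod_eq_pow (fun z => Real.exp (g z))] at h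
  have h1 : (∫ z, Real.exp (g z) ∂μ) ^ Fintype.card (Fin n) ≤ 1 :=
    pow_le_one₀ (integral_nonneg fun z => (Real.exp_pos _).le) hg
  have h2 : {z : Fin n → Z | Real.exp t ≤ ∏ i, Real.exp (g (z i))} = {z | t ≤ ∑ i, g (z i)} := by
    ext z
    simp only [Set.mem_ofPred_eq, ← Real.exp_sum, Real.exp_le_exp]
  rw [h2] at h
  rw [← ofReal_measureReal]
  refine ENNReal.ofReal_le_ofReal ?_
  rw [Real.exp_neg, ← one_div, le_div_iff₀ (Real.exp_pos t), mul_comm]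
  exact h.trans h1

theorem integrable_exp_of_abs_le {g : Z → ℝ} (hg : Measurable g) {C : ℝ} (hC : ∀ z, |g z| ≤ C) :
    Integrable (fun z => Real.exp (g z)) μ :=
  Integrable.of_bound (hg.exp.aestronglyMeasurable) (Real.exp C) (Filter.Eventually.of_forall
    fun z => by
      rw [Real.norm_of_nonneg (Real.exp_pos _).le]
      exact Real.exp_le_exp.mpr ((le_abs_self _).trans (hC z)))

/-- Multiplicative Chernoff bound, from `exp u ≤ 1 + 2 u` on `[0, 1]`. The factor 2 on the mean
leaves an additive error `B t` free of `n`, which a rate linear in `1 / n` for `E[W²]` requires. -/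
theorem pi_upper_deviation_le {n : ℕ} {φ : Z → ℝ} (hφ : Measurable φ) {B : ℝ} (hB : 0 < B)
    (h0 : ∀ z, 0 ≤ φ z) (hφB : ∀ z, φ z ≤ B) (t : ℝ) :
    Measure.pi (fun _ : Fin n => μ) {z | 2 * (n * ∫ u, φ u ∂μ) + B * t ≤ ∑ i, φ (z i)} ≤
      ENNReal.ofReal (Real.exp (-t)) := by
  set m := ∫ u, φ u ∂μ
  have hφi : Integrable φ μ := Integrable.of_bound hφ.aestronglyMeasurable B
    (Filter.Eventually.of_forall fun z => by rw [Real.norm_of_nonneg (h0 z)]; exact hφB z)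
  have hi : Integrable (fun z => Real.exp (φ z / B)) μ :=
    integrable_exp_of_abs_le (hφ.div_const B) (C := 1) fun z => by
      rw [abs_of_nonneg (div_nonneg (h0 z) hB.le)]
      exact (div_le_one hB).mpr (hφB z)
  have e : (fun z => Real.exp (φ z / B - 2 * m / B)) =
      fun z => Real.exp (φ z / B) * Real.exp (-(2 * m / B)) := by
    ext z; rw [sub_eq_add_neg, Real.exp_add]
  refine le_trans (measure_mono fun z hz => ?_) (pi_le_sum_le_exp_neg (μ := μ) (n := n)
    (g := fun z => φ z / B - 2 * m / B) ?_ ?_ t)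
  · simp only [Set.mem_ofPred_eq] at hz ⊢
    rw [Finset.sum_sub_distrib, ← Finset.sum_div]
    simp only [Finset.sum_const, Finset.card_univ, Fintype.card_fin, nsmul_eq_mul]
    rw [show (∑ i, φ (z i)) / B - n * (2 * m / B) = ((∑ i, φ (z i)) - 2 * (n * m)) / B by ring,
      le_div_iff₀ hB]
    linarith
  · rw [e]; exact hi.mul_const _
  · rw [e, integral_mul_const]
    have h1 : ∫ z, Real.exp (φ z / B) ∂μ ≤ ∫ z, (1 + 2 / B * φ z) ∂μ := by
      refine integral_mono hi ((integrable_const _).add (hφi.const_mul _)) fun z => ?_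
      have hx0 : 0 ≤ φ z / B := div_nonneg (h0 z) hB.le
      have hx1 : φ z / B ≤ 1 := (div_le_one hB).mpr (hφB z)
      have := Real.abs_exp_sub_one_le (x := φ z / B) (by rwa [abs_of_nonneg hx0])
      rw [abs_of_nonneg hx0] at this
      have h2 := (le_abs_self _).trans this
      have : 2 / B * φ z = 2 * (φ z / B) := by ring
      simp only [this]
      linarith
    rw [integral_add (integrable_const _) (hφi.const_mul _), integral_const_mul] at h1
    simp only [integral_const, probReal_univ, smul_eq_mul, mul_one] at h1
    have h2 := h1.trans ((add_comm (1 : ℝ) _).trans_le (Real.add_one_le_exp (2 / B * m)))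
    calc _ ≤ Real.exp (2 / B * m) * Real.exp (-(2 * m / B)) := by gcongr
      _ = 1 := by rw [← Real.exp_add, ← Real.exp_zero]; congr 1; ring

theorem exp_neg_le_one_sub_half {x : ℝ} (h0 : 0 ≤ x) (h1 : x ≤ 1) : Real.exp (-x) ≤ 1 - x / 2 := by
  have h := Real.abs_exp_sub_one_sub_id_le (x := -x) (by rwa [abs_neg, abs_of_nonneg h0])
  have h2 := (le_abs_self _).trans h
  -- For small `x`, `exp (-x) ≤ 1 - x + x²` suffices. For larger `x`, `exp x ≥ 1 + x + x² / 2` is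
  -- inverted.
  rcases le_total x (1 / 2) with hx | hx
  · nlinarith
  · have h3 : Real.exp (-x) * (1 + x + x ^ 2 / 2) ≤ 1 := by
      have := Real.quadratic_le_exp_of_nonneg h0
      calc _ ≤ Real.exp (-x) * Real.exp x := by gcongr
        _ = 1 := by rw [← Real.exp_add]; simp
    by_contra! hcon
    have h4 : (1 - x / 2) * (1 + x + x ^ 2 / 2) < Real.exp (-x) * (1 + x + x ^ 2 / 2) :=
      mul_lt_mul_of_pos_right hcon (by positivity)
    nlinarith [mul_nonneg h0 (sub_nonneg.mpr h1), mul_nonneg (sq_nonneg x) (sub_nonneg.mpr h1)]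

/-- The mirror bound, from `exp (-u) ≤ 1 - u / 2` on `[0, 1]`; it converts empirical control into
population control. -/
theorem pi_lower_deviation_le {n : ℕ} {φ : Z → ℝ} (hφ : Measurable φ) {B : ℝ} (hB : 0 < B)
    (h0 : ∀ z, 0 ≤ φ z) (hφB : ∀ z, φ z ≤ B) (t : ℝ) :
    Measure.pi (fun _ : Fin n => μ) {z | 2 * ∑ i, φ (z i) + 2 * B * t ≤ n * ∫ u, φ u ∂μ} ≤
      ENNReal.ofReal (Real.exp (-t)) := by
  set m := ∫ u, φ u ∂μ
  have hφi : Integrable φ μ := Integrable.of_bound hφ.aestronglyMeasurable B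
    (Filter.Eventually.of_forall fun z => by rw [Real.norm_of_nonneg (h0 z)]; exact hφB z)
  have hi : Integrable (fun z => Real.exp (-(φ z / B))) μ :=
    integrable_exp_of_abs_le (hφ.div_const B).neg (C := 1) fun z => by
      rw [abs_neg, abs_of_nonneg (div_nonneg (h0 z) hB.le)]
      exact (div_le_one hB).mpr (hφB z)
  have e : (fun z => Real.exp (m / (2 * B) - φ z / B)) =
      fun z => Real.exp (-(φ z / B)) * Real.exp (m / (2 * B)) := by
    ext z; rw [← Real.exp_add]; congr 1; ring
  refine le_trans (measure_mono fun z hz => ?_) (pi_le_sum_le_exp_neg (μ := μ) (n := n)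
    (g := fun z => m / (2 * B) - φ z / B) ?_ ?_ t)
  · simp only [Set.mem_ofPred_eq] at hz ⊢
    rw [Finset.sum_sub_distrib, ← Finset.sum_div _ (fun i => φ (z i))]
    simp only [Finset.sum_const, Finset.card_univ, Fintype.card_fin, nsmul_eq_mul]
    rw [show n * (m / (2 * B)) - (∑ i, φ (z i)) / B = (n * m - 2 * (∑ i, φ (z i))) / (2 * B) by
      field_simp, le_div_iff₀ (by positivity)]
    linarith
  · rw [e]; exact hi.mul_const _
  · rw [e, integral_mul_const]
    have h1 : ∫ z, Real.exp (-(φ z / B)) ∂μ ≤ ∫ z, (1 - 1 / (2 * B) * φ z) ∂μ := by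
      refine integral_mono hi ((integrable_const _).sub (hφi.const_mul _)) fun z => ?_
      have := exp_neg_le_one_sub_half (x := φ z / B) (div_nonneg (h0 z) hB.le)
        ((div_le_one hB).mpr (hφB z))
      refine this.trans (le_of_eq ?_)
      field_simp
    rw [integral_sub (integrable_const _) (hφi.const_mul _), integral_const_mul] at h1
    simp only [integral_const, probReal_univ, smul_eq_mul, mul_one] at h1
    have h2 := h1.trans ((by ring : (1 : ℝ) - 1 / (2 * B) * m = -(m / (2 * B)) + 1).trans_le
      (Real.add_one_le_exp _))
    calc _ ≤ Real.exp (-(m / (2 * B))) * Real.exp (m / (2 * B)) := by gcongr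
      _ = 1 := by rw [← Real.exp_add]; simp

/-- Hoeffding's inequality. -/
theorem pi_hoeffding_le {n : ℕ} (hn : 0 < n) {φ : Z → ℝ} (hφ : Measurable φ) {a b : ℝ}
    (hab : a < b) (hφab : ∀ᵐ z ∂μ, φ z ∈ Set.Icc a b) {t : ℝ} (ht : 0 ≤ t) :
    Measure.pi (fun _ : Fin n => μ)
      {z | n * ∫ u, φ u ∂μ + (b - a) * √(n * t / 2) ≤ ∑ i, φ (z i)} ≤
      ENNReal.ofReal (Real.exp (-t)) := by
  set m := ∫ u, φ u ∂μ
  have hn0 : (0 : ℝ) < n := by exact_mod_cast hn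
  have hB : 0 < b - a := sub_pos.mpr hab
  have hsub := ProbabilityTheory.hasSubgaussianMGF_of_mem_Icc hφ.aemeasurable hφab
  -- The optimal tilt: the linear term contributes `2 t` and the sub-Gaussian correction costs `t`.
  set s : ℝ := √(8 * t / n) / (b - a) with hs
  have hsB : s * (b - a) = √(8 * t / n) := by rw [hs]; field_simp
  have hsq : n * (s ^ 2 * (b - a) ^ 2 / 8) = t := by
    rw [← mul_pow, hsB, Real.sq_sqrt (by positivity)]
    field_simp
  have hprod : s * ((b - a) * √(n * t / 2)) = 2 * t := by
    rw [← mul_assoc, hsB, ← Real.sqrt_mul (by positivity)]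
    rw [show 8 * t / n * (n * t / 2) = (2 * t) ^ 2 by field_simp; ring]
    exact Real.sqrt_sq (by positivity)
  have e : (fun z => Real.exp (s * (φ z - m) - s ^ 2 * (b - a) ^ 2 / 8)) =
      fun z => Real.exp (s * (φ z - m)) * Real.exp (-(s ^ 2 * (b - a) ^ 2 / 8)) := by
    ext z; rw [← Real.exp_add, sub_eq_add_neg]
  refine le_trans (measure_mono fun z hz => ?_) (pi_le_sum_le_exp_neg (μ := μ) (n := n)
    (g := fun z => s * (φ z - m) - s ^ 2 * (b - a) ^ 2 / 8) ?_ ?_ t)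
  · simp only [Set.mem_ofPred_eq] at hz ⊢
    rw [Finset.sum_sub_distrib, ← Finset.mul_sum, Finset.sum_sub_distrib]
    simp only [Finset.sum_const, Finset.card_univ, Fintype.card_fin, nsmul_eq_mul]
    rw [hsq]
    have hs0 : 0 ≤ s := by positivity
    have := mul_le_mul_of_nonneg_left hz hs0
    rw [mul_add, hprod] at this
    linarith
  · rw [e]; exact (hsub.integrable_exp_mul s).mul_const _
  · rw [e, integral_mul_const]
    have h1 := hsub.mgf_le s
    have h2 : ((((‖b - a‖₊ / 2) ^ 2 : NNReal) : ℝ)) * s ^ 2 / 2 = s ^ 2 * (b - a) ^ 2 / 8 := by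
      push_cast
      rw [Real.norm_of_nonneg hB.le]
      ring
    rw [h2] at h1
    calc _ ≤ Real.exp (s ^ 2 * (b - a) ^ 2 / 8) * Real.exp (-(s ^ 2 * (b - a) ^ 2 / 8)) := by
          gcongr; exact h1
      _ = 1 := by rw [← Real.exp_add]; simp

end Deviation

/-! ### Integrals against the law of a record -/

theorem lintegral_toMeasure_bind {A B : Type*} [Countable A] [Countable B]
    [MeasurableSpace A] [DiscreteMeasurableSpace A] [MeasurableSpace B] [DiscreteMeasurableSpace B]
    (p : PMF A) (k : A → PMF B) (f : B → ℝ≥0∞) :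
    ∫⁻ u, f u ∂(p.bind k).toMeasure = ∫⁻ a, ∫⁻ u, f u ∂(k a).toMeasure ∂p.toMeasure := by
  simp only [lintegral_countable', PMF.toMeasure_apply_singleton _ _ (MeasurableSet.of_discrete),
    PMF.bind_apply, ← ENNReal.tsum_mul_left, ← ENNReal.tsum_mul_right]
  rw [ENNReal.tsum_comm]
  refine tsum_congr fun a => tsum_congr fun u => ?_
  ring

theorem ae_mem_support {A : Type*} [MeasurableSpace A] [DiscreteMeasurableSpace A]
    (p : PMF A) : ∀ᵐ a ∂p.toMeasure, a ∈ p.support := by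
  rw [ae_iff, PMF.toMeasure_apply_eq_zero_iff _ (MeasurableSet.of_discrete)]
  exact disjoint_compl_right

section Edit

variable {X Y : Type*} [Countable X] [Countable Y] [MeasurableSpace X] [DiscreteMeasurableSpace X]
  [MeasurableSpace Y] [DiscreteMeasurableSpace Y]

theorem lintegral_editLaw (ρ : PMF X) (πref : Policy X Y) (q : X → Y → PMF Y)
    (f : X × Y × Y → ℝ≥0∞) :
    ∫⁻ z, f z ∂(editLaw ρ πref q).toMeasure =
      ∫⁻ x, ∫⁻ y, ∫⁻ y', f (x, y, y') ∂(q x y).toMeasure ∂(πref x).toMeasure ∂ρ.toMeasure := by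
  unfold editLaw
  simp only [lintegral_toMeasure_bind]
  refine lintegral_congr fun x => lintegral_congr fun y => ?_
  rw [← PMF.toMeasure_map (f := fun y' => (x, y, y')) (p := q x y) (hf := Measurable.of_discrete),
    lintegral_map (Measurable.of_discrete) (Measurable.of_discrete)]

theorem abs_integral_le_of_abs_le {A : Type*} [MeasurableSpace A] (μ : Measure A)
    [IsProbabilityMeasure μ] {f : A → ℝ} {M : ℝ} (hf : ∀ a, |f a| ≤ M) : |∫ a, f a ∂μ| ≤ M := by
  simpa using norm_integral_le_of_norm_le_const (μ := μ) (f := f) (C := M)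
    (Filter.Eventually.of_forall hf)

/-- Given `(x, y)`, the noise `Δ - c` is centred and lies in an interval of length `M`, so
Hoeffding's lemma bounds the inner integral by 1 for any tilt `s (x, y)`. -/
theorem integral_exp_noise_le {ρ : PMF X} {πref : Policy X Y} {q : X → Y → PMF Y} {Δ : Y → Y → ℝ}
    {M : ℝ} (hM : 0 < M) (hΔ : ∀ y y', 0 ≤ Δ y y' ∧ Δ y y' ≤ M) {s : X × Y → ℝ} {S : ℝ}
    (hs : ∀ z, |s z| ≤ S) :
    Integrable (fun z : X × Y × Y => Real.exp (s (z.1, z.2.1) * (Δ z.2.1 z.2.2 -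
      expectedCost q Δ (z.1, z.2.1)) - M ^ 2 * s (z.1, z.2.1) ^ 2 / 8))
      (editLaw ρ πref q).toMeasure ∧
    ∫ z : X × Y × Y, Real.exp (s (z.1, z.2.1) * (Δ z.2.1 z.2.2 -
      expectedCost q Δ (z.1, z.2.1)) - M ^ 2 * s (z.1, z.2.1) ^ 2 / 8)
      ∂(editLaw ρ πref q).toMeasure ≤ 1 := by
  have hΔ' : ∀ y y', |Δ y y'| ≤ M := fun y y' => by
    rw [abs_of_nonneg (hΔ y y').1]; exact (hΔ y y').2
  have hc : ∀ z, |expectedCost q Δ z| ≤ M := fun z => abs_integral_le_of_abs_le _ fun y' => hΔ' _ _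
  have hint : Integrable (fun z : X × Y × Y => Real.exp (s (z.1, z.2.1) * (Δ z.2.1 z.2.2 -
      expectedCost q Δ (z.1, z.2.1)) - M ^ 2 * s (z.1, z.2.1) ^ 2 / 8))
      (editLaw ρ πref q).toMeasure := by
    refine integrable_exp_of_abs_le (Measurable.of_discrete) (C := S * (M + M) + M ^ 2 * S ^ 2 / 8)
      fun z => ?_
    have h1 := hs (z.1, z.2.1)
    have hS : 0 ≤ S := (abs_nonneg _).trans h1
    refine (abs_sub _ _).trans (add_le_add ?_ ?_)
    · rw [abs_mul]
      exact mul_le_mul h1 ((abs_sub _ _).trans (add_le_add (hΔ' _ _) (hc _))) (abs_nonneg _) hS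
    · rw [abs_of_nonneg (by positivity), ← sq_abs (s _)]
      gcongr
  refine ⟨hint, ?_⟩
  rw [← ENNReal.ofReal_le_ofReal_iff zero_le_one,
    ofReal_integral_eq_lintegral_ofReal hint (Filter.Eventually.of_forall fun z =>
      (Real.exp_pos _).le), lintegral_editLaw, ENNReal.ofReal_one]
  have hinner : ∀ x y, ∫⁻ y', ENNReal.ofReal (Real.exp (s (x, y) * (Δ y y' -
      expectedCost q Δ (x, y)) - M ^ 2 * s (x, y) ^ 2 / 8)) ∂(q x y).toMeasure ≤ 1 := by
    intro x y
    have hsub := ProbabilityTheory.hasSubgaussianMGF_of_mem_Icc (μ := (q x y).toMeasure)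
      (X := fun y' => Δ y y') (a := 0) (b := M) (Measurable.of_discrete).aemeasurable
      (Filter.Eventually.of_forall fun y' => hΔ y y')
    have h1 := hsub.mgf_le (s (x, y))
    have h2 : ((((‖M - 0‖₊ / 2) ^ 2 : NNReal) : ℝ)) * s (x, y) ^ 2 / 2
        = M ^ 2 * s (x, y) ^ 2 / 8 := by
      push_cast
      rw [sub_zero, Real.norm_of_nonneg hM.le]
      ring
    rw [h2] at h1
    have e : ∀ y', Real.exp (s (x, y) * (Δ y y' -
        expectedCost q Δ (x, y)) - M ^ 2 * s (x, y) ^ 2 / 8) =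
        Real.exp (s (x, y) * (Δ y y' - ∫ y', Δ y y' ∂(q x y).toMeasure)) *
          Real.exp (-(M ^ 2 * s (x, y) ^ 2 / 8)) := fun y' => by
      rw [← Real.exp_add, sub_eq_add_neg]; rfl
    simp only [e]
    rw [← ofReal_integral_eq_lintegral_ofReal ((hsub.integrable_exp_mul _).mul_const _)
      (Filter.Eventually.of_forall fun y' => by positivity), integral_mul_const]
    refine ENNReal.ofReal_le_one.mpr ?_
    calc _ ≤ Real.exp (M ^ 2 * s (x, y) ^ 2 / 8) * Real.exp (-(M ^ 2 * s (x, y) ^ 2 / 8)) := by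
          gcongr; exact h1
      _ = 1 := by rw [← Real.exp_add]; simp
  calc _ ≤ ∫⁻ _x, ∫⁻ y, 1 ∂(πref _x).toMeasure ∂ρ.toMeasure :=
        lintegral_mono fun x => lintegral_mono fun y => hinner x y
    _ = 1 := by simp

/-- A function that fits the observed costs at least as well as the expected cost is close to it
on the data. -/
theorem offlineLaw_squaredLoss_le {n : ℕ} (hn : 0 < n) {ρ : PMF X} {πref : Policy X Y}
    {q : X → Y → PMF Y} {Δ : Y → Y → ℝ} {M : ℝ} (hM : 0 < M)
    (hΔ : ∀ y y', 0 ≤ Δ y y' ∧ Δ y y' ≤ M) {f : X × Y → ℝ} (hf : ∀ z, |f z| ≤ M) (t : ℝ) :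
    offlineLaw n ρ πref q {D | squaredLoss Δ D f ≤ squaredLoss Δ D (expectedCost q Δ) ∧
      2 * M ^ 2 * t ≤ ∑ i, (f ((D i).1, (D i).2.1) - expectedCost q Δ ((D i).1, (D i).2.1)) ^ 2} ≤
      ENNReal.ofReal (Real.exp (-t)) := by
  set c := expectedCost q Δ with hcdef
  have hc : ∀ z, |c z| ≤ M := fun z => abs_integral_le_of_abs_le _ fun y' => by
    rw [abs_of_nonneg (hΔ _ _).1]; exact (hΔ _ _).2
  -- With tilt `2 (f - c) / M²`, the exponent is `1 / M²` times the excess loss of `c` over `f` plus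
  -- half of `(f - c)²`. If `f` fits no worse than `c`, its sum is at least the squared distance
  -- over `2 M²`.
  obtain ⟨h1, h2⟩ := integral_exp_noise_le (ρ := ρ) (πref := πref) (q := q) hM hΔ
    (s := fun z => 2 / M ^ 2 * (f z - c z)) (S := 2 / M ^ 2 * (M + M)) fun z => by
      rw [abs_mul, abs_of_pos (by positivity : 0 < 2 / M ^ 2)]
      gcongr
      exact (abs_sub _ _).trans (add_le_add (hf z) (hc z))
  refine le_trans (measure_mono fun D hD => ?_)
    (pi_le_sum_le_exp_neg (n := n) (g := fun z : X × Y × Y => 2 / M ^ 2 *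
      (f (z.1, z.2.1) - c (z.1, z.2.1)) * (Δ z.2.1 z.2.2 - c (z.1, z.2.1)) -
      M ^ 2 * (2 / M ^ 2 * (f (z.1, z.2.1) - c (z.1, z.2.1))) ^ 2 / 8) h1 h2 t)
  obtain ⟨hD1, hD2⟩ := hD
  have hn0 : (0 : ℝ) < 1 / n := by
    have : (0 : ℝ) < n := by exact_mod_cast hn
    positivity
  have hD1 := le_of_mul_le_mul_left hD1 hn0
  have e : ∀ i, 2 / M ^ 2 * (f ((D i).1, (D i).2.1) - c ((D i).1, (D i).2.1)) *
      (Δ (D i).2.1 (D i).2.2 - c ((D i).1, (D i).2.1)) -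
      M ^ 2 * (2 / M ^ 2 * (f ((D i).1, (D i).2.1) - c ((D i).1, (D i).2.1))) ^ 2 / 8 =
      1 / M ^ 2 * ((c ((D i).1, (D i).2.1) - Δ (D i).2.1 (D i).2.2) ^ 2 -
        (f ((D i).1, (D i).2.1) - Δ (D i).2.1 (D i).2.2) ^ 2 +
        1 / 2 * (f ((D i).1, (D i).2.1) - c ((D i).1, (D i).2.1)) ^ 2) := by
    intro i
    field_simp
    ring
  simp only [Set.mem_ofPred_eq, e]
  rw [← Finset.mul_sum, Finset.sum_add_distrib, Finset.sum_sub_distrib, ← Finset.mul_sum,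
    one_div_mul_eq_div, le_div_iff₀ (by positivity)]
  linarith

end Edit

/-! ### The regularized cost, shifted to be nonnegative -/

section Shift

variable {X Y : Type*} [MeasurableSpace Y]

/-- The regularized cost at `x` of the cost `f + M`. -/
def shiftedCostAt (πref : Policy X Y) (β M : ℝ) (f : X × Y → ℝ)
    (π : Policy X Y) (x : X) : ℝ≥0∞ :=
  ∫⁻ y, ENNReal.ofReal (f (x, y) + M) ∂(π x).toMeasure +
    ENNReal.ofReal β * InformationTheory.klDiv (π x).toMeasure (πref x).toMeasure

theorem shiftedCostAt_ref_le {πref : Policy X Y} {β M : ℝ} {f : X × Y → ℝ}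
    (hf : ∀ z, |f z| ≤ M) (x : X) : shiftedCostAt πref β M f πref x ≤ ENNReal.ofReal (2 * M) := by
  unfold shiftedCostAt
  rw [InformationTheory.klDiv_self, mul_zero, add_zero]
  calc _ ≤ ∫⁻ _y, ENNReal.ofReal (2 * M) ∂(πref x).toMeasure := lintegral_mono fun y =>
        ENNReal.ofReal_le_ofReal (by linarith [(abs_le.mp (hf (x, y))).2])
    _ = _ := by simp

variable [DiscreteMeasurableSpace Y]

theorem lintegral_ofReal_add {A : Type*} [MeasurableSpace A] [DiscreteMeasurableSpace A]
    (μ : Measure A) [IsProbabilityMeasure μ] {f : A → ℝ} {M : ℝ} (hf : ∀ a, |f a| ≤ M) :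
    ((∫⁻ a, ENNReal.ofReal (f a + M) ∂μ : ℝ≥0∞) : EReal) = ((∫ a, f a ∂μ + M : ℝ) : EReal) := by
  have hfi : Integrable f μ := Integrable.of_bound
    (Measurable.of_discrete).aestronglyMeasurable M (Filter.Eventually.of_forall hf)
  have h0 : ∀ a, 0 ≤ f a + M := fun a => by linarith [(abs_le.mp (hf a)).1]
  rw [← ofReal_integral_eq_lintegral_ofReal (f := fun a => f a + M)
    (hfi.add (integrable_const M))
    (Filter.Eventually.of_forall h0), integral_add hfi (integrable_const M)]
  simp only [integral_const, probReal_univ, smul_eq_mul, one_mul]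
  rw [EReal.coe_ennreal_ofReal, max_eq_left]
  linarith [(abs_le.mp (abs_integral_le_of_abs_le μ hf)).1]

theorem coe_eq_coe_add_add_coe_neg (r M : ℝ) :
    (r : EReal) = ((r + M : ℝ) : EReal) + ((-M : ℝ) : EReal) := by
  rw [← EReal.coe_add]
  congr 1
  ring

theorem ereal_coe_sum {ι : Type*} (s : Finset ι) (f : ι → ℝ) :
    ((∑ i ∈ s, f i : ℝ) : EReal) = ∑ i ∈ s, (f i : EReal) := by
  classical
  induction s using Finset.induction_on with
  | empty => simp
  | insert a s ha ih => rw [Finset.sum_insert ha, Finset.sum_insert ha, EReal.coe_add, ih]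

/-- Shifting by the finite constant `M` moves the analysis to `ℝ≥0∞`, where an infinite divergence
needs no special treatment. -/
theorem regCostAt_eq {πref : Policy X Y} {β M : ℝ} {f : X × Y → ℝ} (hf : ∀ z, |f z| ≤ M)
    (π : Policy X Y) (x : X) :
    regCostAt πref β f π x = (shiftedCostAt πref β M f π x : EReal) + ((-M : ℝ) : EReal) := by
  unfold regCostAt shiftedCostAt
  rw [EReal.coe_ennreal_add, lintegral_ofReal_add _ fun y => hf (x, y), add_right_comm,
    ← coe_eq_coe_add_add_coe_neg]

/-- The lower bound `-M` holds automatically, because the cost is at least `-M` and the divergence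
is nonnegative. -/
theorem mem_boundedPolicies_iff {ρ : PMF X} {πref : Policy X Y} {β M : ℝ} {f : X × Y → ℝ}
    (hf : ∀ z, |f z| ≤ M) (π : Policy X Y) : π ∈ boundedPolicies ρ πref β M f ↔
      ∀ x ∈ ρ.support, shiftedCostAt πref β M f π x ≤ ENNReal.ofReal (2 * M) := by
  refine forall₂_congr fun x _ => ?_
  have hM : 0 ≤ M := (abs_nonneg _).trans (hf (x, ((π x).support_nonempty).some))
  rw [regCostAt_eq hf]
  have h1 : ((-M : ℝ) : EReal) ≤ (shiftedCostAt πref β M f π x : EReal) + ((-M : ℝ) : EReal) :=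
    le_add_of_nonneg_left (EReal.coe_ennreal_nonneg _)
  have h2 : ((ENNReal.ofReal (2 * M) : ℝ≥0∞) : EReal) = ((M + M : ℝ) : EReal) := by
    rw [EReal.coe_ennreal_ofReal, max_eq_left (by positivity), two_mul]
  rw [and_iff_right h1, ← EReal.coe_ennreal_le_coe_ennreal_iff, h2, coe_eq_coe_add_add_coe_neg M M]
  constructor
  · intro h
    have h3 := add_le_add_left h ((M : ℝ) : EReal)
    rwa [add_assoc, add_assoc, ← EReal.coe_add, neg_add_cancel, EReal.coe_zero, add_zero,
      add_zero] at h3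
  · intro h
    exact add_le_add_left h _

theorem sum_regCostAt_eq {ρ : PMF X} {πref : Policy X Y} {β M : ℝ} {f : X × Y → ℝ}
    (hf : ∀ z, |f z| ≤ M) {π : Policy X Y} (hπ : π ∈ boundedPolicies ρ πref β M f) {n : ℕ}
    {x : Fin n → X} (hx : ∀ i, x i ∈ ρ.support) :
    ∑ i, regCostAt πref β f π (x i) =
      ((∑ i, (shiftedCostAt πref β M f π (x i)).toReal - n * M : ℝ) : EReal) := by
  have h : ∀ i, regCostAt πref β f π (x i) =
      (((shiftedCostAt πref β M f π (x i)).toReal - M : ℝ) : EReal) := by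
    intro i
    have hfin : shiftedCostAt πref β M f π (x i) ≠ ⊤ :=
      (((mem_boundedPolicies_iff hf π).mp hπ (x i) (hx i)).trans_lt ENNReal.ofReal_lt_top).ne
    rw [regCostAt_eq hf, sub_eq_add_neg, EReal.coe_add, EReal.coe_ennreal_toReal hfin]
  simp only [h]
  rw [← ereal_coe_sum, Finset.sum_sub_distrib]
  simp

variable [MeasurableSpace X] [DiscreteMeasurableSpace X]

theorem regObjective_eq {ρ : PMF X} {πref : Policy X Y} {β M : ℝ} {f : X × Y → ℝ}
    (hf : ∀ z, |f z| ≤ M) (π : Policy X Y) :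
    regObjective ρ πref β f π =
      ((∫⁻ x, shiftedCostAt πref β M f π x ∂ρ.toMeasure : ℝ≥0∞) : EReal) + ((-M : ℝ) : EReal) := by
  unfold regObjective shiftedCostAt
  have e : ∀ x, ∫⁻ y, ENNReal.ofReal (f (x, y) + M) ∂(π x).toMeasure =
      ENNReal.ofReal (∫ y, f (x, y) ∂(π x).toMeasure + M) := by
    intro x
    have h := lintegral_ofReal_add (π x).toMeasure fun y => hf (x, y)
    rw [← EReal.coe_ennreal_eq_coe_ennreal_iff, h, EReal.coe_ennreal_ofReal, max_eq_left]
    linarith [(abs_le.mp (abs_integral_le_of_abs_le (π x).toMeasure fun y => hf (x, y))).1]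
  rw [lintegral_add_left (Measurable.of_discrete), lintegral_const_mul _ (Measurable.of_discrete)]
  simp only [e]
  rw [EReal.coe_ennreal_add, lintegral_ofReal_add _ fun x =>
    abs_integral_le_of_abs_le (π x).toMeasure fun y => hf (x, y), add_right_comm,
    ← coe_eq_coe_add_add_coe_neg]

theorem regObjective_le_iff {ρ : PMF X} {πref : Policy X Y} {β M : ℝ} {f : X × Y → ℝ}
    (hf : ∀ z, |f z| ≤ M) (π π' : Policy X Y) (a : ℝ≥0∞) :
    regObjective ρ πref β f π ≤ regObjective ρ πref β f π' + (a : EReal) ↔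
      ∫⁻ x, shiftedCostAt πref β M f π x ∂ρ.toMeasure ≤
        ∫⁻ x, shiftedCostAt πref β M f π' x ∂ρ.toMeasure + a := by
  rw [regObjective_eq hf, regObjective_eq hf, add_right_comm, ← EReal.coe_ennreal_add]
  constructor
  · intro h
    have h2 := add_le_add_left h ((M : ℝ) : EReal)
    rwa [add_assoc, add_assoc, ← EReal.coe_add, neg_add_cancel, EReal.coe_zero, add_zero, add_zero,
      EReal.coe_ennreal_le_coe_ennreal_iff] at h2
  · intro h
    exact add_le_add_left (EReal.coe_ennreal_le_coe_ennreal_iff.mpr h) _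

theorem IsRegOptimal.lintegral_le {ρ : PMF X} {πref : Policy X Y} {β M : ℝ} {f : X × Y → ℝ}
    (hf : ∀ z, |f z| ≤ M) {π : Policy X Y} (h : IsRegOptimal ρ πref β f π) (π' : Policy X Y) :
    ∫⁻ x, shiftedCostAt πref β M f π x ∂ρ.toMeasure ≤
      ∫⁻ x, shiftedCostAt πref β M f π' x ∂ρ.toMeasure := by
  have := (regObjective_le_iff hf π π' 0).mp (by simpa using h π')
  simpa using this

theorem IsRegOptimal.lintegral_lt_top {ρ : PMF X} {πref : Policy X Y} {β M : ℝ} {f : X × Y → ℝ}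
    (hf : ∀ z, |f z| ≤ M) {π : Policy X Y} (h : IsRegOptimal ρ πref β f π) :
    ∫⁻ x, shiftedCostAt πref β M f π x ∂ρ.toMeasure < ⊤ := by
  refine (h.lintegral_le hf πref).trans_lt ?_
  calc _ ≤ ∫⁻ _x, ENNReal.ofReal (2 * M) ∂ρ.toMeasure :=
        lintegral_mono fun x => shiftedCostAt_ref_le hf x
    _ < ⊤ := by
      rw [lintegral_const, measure_univ, mul_one]
      exact ENNReal.ofReal_lt_top

/-- An optimal policy is optimal at every context of the support. -/
theorem IsRegOptimal.shiftedCostAt_le {ρ : PMF X} {πref : Policy X Y} {β M : ℝ} {f : X × Y → ℝ}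
    (hf : ∀ z, |f z| ≤ M) {π : Policy X Y} (h : IsRegOptimal ρ πref β f π) {x : X}
    (hx : x ∈ ρ.support) : shiftedCostAt πref β M f π x ≤ ENNReal.ofReal (2 * M) := by
  classical
  -- Compare with `πref`, which has zero divergence. If it were strictly better at `x`, switching to
  -- it at this single context of positive mass would lower a finite objective.
  refine le_trans ?_ (shiftedCostAt_ref_le (πref := πref) (β := β) hf x)
  by_contra! hlt
  have e1 : shiftedCostAt πref β M f (Function.update π x (πref x)) x =
      shiftedCostAt πref β M f πref x := by
    unfold shiftedCostAt; rw [Function.update_self]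
  have e2 : ∀ u, u ≠ x → shiftedCostAt πref β M f (Function.update π x (πref x)) u =
      shiftedCostAt πref β M f π u := by
    intro u hu
    unfold shiftedCostAt; rw [Function.update_of_ne hu]
  have hle : ∀ u, shiftedCostAt πref β M f (Function.update π x (πref x)) u ≤
      shiftedCostAt πref β M f π u := by
    intro u
    rcases eq_or_ne u x with rfl | hu
    · rw [e1]; exact hlt.le
    · exact (e2 u hu).le
  have hfin : ∫⁻ u, shiftedCostAt πref β M f (Function.update π x (πref x)) u ∂ρ.toMeasure ≠ ⊤ :=
    ((lintegral_mono hle).trans_lt (h.lintegral_lt_top hf)).ne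
  refine (h.lintegral_le hf (Function.update π x (πref x))).not_gt ?_
  refine lintegral_strict_mono_of_ae_le_of_ae_lt_on (s := {x})
    (Measurable.of_discrete).aemeasurable hfin (Filter.Eventually.of_forall hle) ?_ ?_
  · rw [PMF.toMeasure_apply_singleton _ _ (MeasurableSet.of_discrete)]
    exact (PMF.mem_support_iff _ _).mp hx
  · refine Filter.Eventually.of_forall fun u hu => ?_
    rw [Set.mem_singleton_iff.mp hu, e1]
    exact hlt
end Shift

/-! ### The policy step -/

section PolicyStep

variable {X Y : Type*} [MeasurableSpace Y] [DiscreteMeasurableSpace Y]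
  [MeasurableSpace X] [DiscreteMeasurableSpace X]

theorem ae_toReal_shiftedCostAt_mem {ρ : PMF X} {πref : Policy X Y} {β M : ℝ} {f : X × Y → ℝ}
    (hM : 0 < M) (hf : ∀ z, |f z| ≤ M) {π : Policy X Y} (hπ : π ∈ boundedPolicies ρ πref β M f) :
    ∀ᵐ x ∂ρ.toMeasure, (shiftedCostAt πref β M f π x).toReal ∈ Set.Icc 0 (2 * M) := by
  filter_upwards [ae_mem_support ρ] with x hx
  refine ⟨ENNReal.toReal_nonneg, ?_⟩
  have := (mem_boundedPolicies_iff hf π).mp hπ x hx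
  exact ENNReal.toReal_le_of_le_ofReal (by positivity) this

theorem lintegral_shiftedCostAt_eq_ofReal {ρ : PMF X} {πref : Policy X Y} {β M : ℝ}
    {f : X × Y → ℝ} (hM : 0 < M) (hf : ∀ z, |f z| ≤ M) {π : Policy X Y}
    (hπ : π ∈ boundedPolicies ρ πref β M f) :
    ∫⁻ x, shiftedCostAt πref β M f π x ∂ρ.toMeasure =
      ENNReal.ofReal (∫ x, (shiftedCostAt πref β M f π x).toReal ∂ρ.toMeasure) := by
  rw [ofReal_integral_eq_lintegral_ofReal (Integrable.of_mem_Icc 0 (2 * M)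
    (Measurable.of_discrete).aemeasurable (ae_toReal_shiftedCostAt_mem hM hf hπ))
    (Filter.Eventually.of_forall fun _ => ENNReal.toReal_nonneg)]
  refine lintegral_congr_ae ?_
  filter_upwards [ae_mem_support ρ] with x hx
  rw [ENNReal.ofReal_toReal]
  exact (((mem_boundedPolicies_iff hf π).mp hπ x hx).trans_lt ENNReal.ofReal_lt_top).ne

/-- With high probability over the fresh contexts, the empirical minimizer is nearly as good as the
optimal policy of the given cost. -/
theorem pi_isRLPolicy_le {n : ℕ} (hn : 0 < n) {ρ : PMF X} {πref : Policy X Y} {β M : ℝ}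
    (hM : 0 < M) {P : Finset (Policy X Y)} {f : X × Y → ℝ} (hf : ∀ z, |f z| ≤ M)
    {π₀ : Policy X Y} (hπ₀ : π₀ ∈ P) (hopt : IsRegOptimal ρ πref β f π₀) {t : ℝ} (ht : 0 ≤ t) :
    Measure.pi (fun _ : Fin n => ρ.toMeasure) {x | ¬ ∀ πhat : Policy X Y,
      IsRLPolicy ρ πref β M P f x πhat → ∫⁻ u, shiftedCostAt πref β M f πhat u ∂ρ.toMeasure ≤
        ∫⁻ u, shiftedCostAt πref β M f π₀ u ∂ρ.toMeasure +
          ENNReal.ofReal (4 * M * √(n * t / 2) / n)} ≤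
      P.card * (2 * ENNReal.ofReal (Real.exp (-t))) := by
  classical
  set h : Policy X Y → X → ℝ := fun π x => (shiftedCostAt πref β M f π x).toReal with hh
  set B := boundedPolicies ρ πref β M f
  set A₁ : Policy X Y → Set (Fin n → X) := fun π =>
    {x | n * ∫ u, h π u ∂ρ.toMeasure + (2 * M - 0) * √(n * t / 2) ≤ ∑ i, h π (x i)} with hA₁
  set A₂ : Policy X Y → Set (Fin n → X) := fun π =>
    {x | n * ∫ u, -h π u ∂ρ.toMeasure + (0 - -(2 * M)) * √(n * t / 2) ≤ ∑ i, -h π (x i)} with hA₂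
  have hn0 : (0 : ℝ) < n := by exact_mod_cast hn
  have hπ₀B : π₀ ∈ B := (mem_boundedPolicies_iff hf π₀).mpr fun x hx => hopt.shiftedCostAt_le hf hx
  -- Off the support nothing bounds the regularized cost, so samples that leave it are discarded as
  -- a null event. Elsewhere, failure forces a one-sided deviation of size `2 M √(n t / 2)` for
  -- `πhat` or `π₀`.
  have hsub : {x | ¬ ∀ πhat : Policy X Y,
      IsRLPolicy ρ πref β M P f x πhat → ∫⁻ u, shiftedCostAt πref β M f πhat u ∂ρ.toMeasure ≤
        ∫⁻ u, shiftedCostAt πref β M f π₀ u ∂ρ.toMeasure +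
          ENNReal.ofReal (4 * M * √(n * t / 2) / n)} ⊆
      {x | ¬ ∀ i, x i ∈ ρ.support} ∪ ⋃ π ∈ P.filter (· ∈ B), (A₁ π ∪ A₂ π) := by
    intro x hx
    by_contra hcon
    simp only [Set.mem_union, Set.mem_iUnion, not_or, Set.mem_ofPred_eq, not_not, not_exists,
      Finset.mem_filter] at hcon
    obtain ⟨hsupp, hgood⟩ := hcon
    refine hx fun πhat hhat => ?_
    obtain ⟨⟨hP, hB⟩, hmin⟩ := hhat
    have h1 := hmin π₀ hπ₀ hπ₀B
    rw [sum_regCostAt_eq hf hB hsupp, sum_regCostAt_eq hf hπ₀B hsupp, EReal.coe_le_coe_iff] at h1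
    have h2 := (hgood πhat ⟨hP, hB⟩).2
    have h3 := (hgood π₀ ⟨hπ₀, hπ₀B⟩).1
    simp only [hA₁, hA₂, Set.mem_ofPred_eq, not_le, integral_neg, Finset.sum_neg_distrib] at h2 h3
    rw [lintegral_shiftedCostAt_eq_ofReal hM hf hB, lintegral_shiftedCostAt_eq_ofReal hM hf hπ₀B,
      ← ENNReal.ofReal_add (integral_nonneg fun _ => ENNReal.toReal_nonneg) (by positivity)]
    refine ENNReal.ofReal_le_ofReal ?_
    rw [← sub_le_iff_le_add', le_div_iff₀ hn0]
    simp only [hh] at h2 h3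
    nlinarith
  have hnull : Measure.pi (fun _ : Fin n => ρ.toMeasure) {x | ¬ ∀ i, x i ∈ ρ.support} = 0 := by
    rw [← ae_iff]
    exact Filter.eventually_all.mpr fun i =>
      (Measure.tendsto_eval_ae_ae (μ := fun _ : Fin n => ρ.toMeasure) (i := i)).eventually
        (ae_mem_support ρ)
  calc _ ≤ _ := measure_mono hsub
    _ ≤ 0 + ∑ π ∈ P.filter (· ∈ B), Measure.pi (fun _ : Fin n => ρ.toMeasure) (A₁ π ∪ A₂ π) :=
        (measure_union_le _ _).trans (add_le_add hnull.le (measure_biUnion_finset_le _ _))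
    _ ≤ ∑ _π ∈ P.filter (· ∈ B), 2 * ENNReal.ofReal (Real.exp (-t)) := by
        rw [zero_add]
        refine Finset.sum_le_sum fun π hπ => ?_
        have hmem := ae_toReal_shiftedCostAt_mem hM hf (Finset.mem_filter.mp hπ).2
        rw [two_mul]
        refine (measure_union_le _ _).trans (add_le_add ?_ ?_)
        · exact pi_hoeffding_le hn (Measurable.of_discrete) (by positivity) hmem ht
        · refine pi_hoeffding_le hn (Measurable.of_discrete) (by linarith) ?_ ht
          filter_upwards [hmem] with x hx
          exact ⟨by linarith [hx.2], by linarith [hx.1]⟩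
    _ ≤ _ := by
        rw [Finset.sum_const, nsmul_eq_mul]
        gcongr
        exact Finset.filter_subset _ _

/-- Both sides use the same policy, so the divergence terms agree and only the costs are compared.
-/
theorem lintegral_shiftedCostAt_le_add_lintegral {ρ : PMF X} {πref : Policy X Y} {β M : ℝ}
    {f g : X × Y → ℝ} (w : X × Y → ℝ) (hfg : ∀ z, f z ≤ g z + w z) (π : Policy X Y) :
    ∫⁻ x, shiftedCostAt πref β M f π x ∂ρ.toMeasure ≤
      ∫⁻ x, shiftedCostAt πref β M g π x ∂ρ.toMeasure +
        ∫⁻ x, ∫⁻ y, ENNReal.ofReal (w (x, y)) ∂(π x).toMeasure ∂ρ.toMeasure := by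
  rw [← lintegral_add_left (Measurable.of_discrete)]
  refine lintegral_mono fun x => ?_
  unfold shiftedCostAt
  rw [add_right_comm]
  gcongr
  rw [← lintegral_add_left (Measurable.of_discrete)]
  refine lintegral_mono fun y => ?_
  refine le_trans (ENNReal.ofReal_le_ofReal ?_) ENNReal.ofReal_add_le
  linarith [hfg (x, y)]

theorem lintegral_shiftedCostAt_le_add_const {ρ : PMF X} {πref : Policy X Y} {β M : ℝ}
    {f g : X × Y → ℝ} {a : ℝ} (hfg : ∀ z, f z ≤ g z + a) (π : Policy X Y) :
    ∫⁻ x, shiftedCostAt πref β M f π x ∂ρ.toMeasure ≤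
      ∫⁻ x, shiftedCostAt πref β M g π x ∂ρ.toMeasure + ENNReal.ofReal a := by
  simpa using lintegral_shiftedCostAt_le_add_lintegral (πref := πref) (β := β) (M := M) (ρ := ρ)
    (fun _ => a) hfg π

/-- Change of measure from an optimal policy to the reference policy. -/
theorem IsRegOptimal.lintegral_le_concentrability_mul [Countable X] [Countable Y] {ρ : PMF X}
    {πref : Policy X Y} {β M : ℝ} (hβ : 0 < β) {f : X × Y → ℝ} (hf : ∀ z, |f z| ≤ M)
    {π : Policy X Y} (h : IsRegOptimal ρ πref β f π) (w : X × Y → ℝ≥0∞) :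
    ∫⁻ x, ∫⁻ y, w (x, y) ∂(π x).toMeasure ∂ρ.toMeasure ≤
      concentrability ρ πref π *
        (∫⁻ x, ∫⁻ y, w (x, y) ^ 2 ∂(πref x).toMeasure ∂ρ.toMeasure) ^ (1 / 2 : ℝ) := by
  -- Optimality makes the divergence finite on the support. This gives absolute continuity, so no
  -- mass is lost where `πref` vanishes.
  have hchange : ∀ x ∈ ρ.support, ∫⁻ y, w (x, y) ∂(π x).toMeasure =
      ∫⁻ y, π x y / πref x y * w (x, y) ∂(πref x).toMeasure := by
    intro x hx
    have hfin := (h.shiftedCostAt_le hf hx).trans_lt ENNReal.ofReal_lt_top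
    have hkl : InformationTheory.klDiv (π x).toMeasure (πref x).toMeasure ≠ ⊤ := by
      intro htop
      rw [shiftedCostAt, htop, ENNReal.mul_top (by simpa using hβ), add_top] at hfin
      exact lt_irrefl _ hfin
    have hac := (InformationTheory.klDiv_ne_top_iff.mp hkl).1
    simp only [lintegral_countable', PMF.toMeasure_apply_singleton _ _ (MeasurableSet.of_discrete)]
    refine tsum_congr fun y => ?_
    by_cases hy : πref x y = 0
    · have := hac (s := {y}) (by
        rw [PMF.toMeasure_apply_singleton _ _ (MeasurableSet.of_discrete), hy])
      rw [PMF.toMeasure_apply_singleton _ _ (MeasurableSet.of_discrete)] at this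
      simp [this, hy]
    · rw [mul_right_comm, ENNReal.div_mul_cancel hy (PMF.apply_ne_top _ _), mul_comm]
  -- A record law with a dummy last coordinate serves as the joint law of `(x, y)`, so that
  -- Cauchy–Schwarz applies to one integral.
  let joint : PMF (X × Y × Y) := editLaw ρ πref fun _ y => PMF.pure y
  have hjoint : ∀ v : X × Y → ℝ≥0∞, ∫⁻ x, ∫⁻ y, v (x, y) ∂(πref x).toMeasure ∂ρ.toMeasure =
      ∫⁻ z, v (z.1, z.2.1) ∂joint.toMeasure := by
    intro v
    rw [lintegral_editLaw]
    simp
  calc ∫⁻ x, ∫⁻ y, w (x, y) ∂(π x).toMeasure ∂ρ.toMeasure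
      = ∫⁻ x, ∫⁻ y, π x y / πref x y * w (x, y) ∂(πref x).toMeasure ∂ρ.toMeasure := by
        refine lintegral_congr_ae ?_
        filter_upwards [ae_mem_support ρ] with x hx using hchange x hx
    _ = ∫⁻ z, π z.1 z.2.1 / πref z.1 z.2.1 * w (z.1, z.2.1) ∂joint.toMeasure :=
        hjoint fun z => π z.1 z.2 / πref z.1 z.2 * w z
    _ ≤ (∫⁻ z, (π z.1 z.2.1 / πref z.1 z.2.1) ^ (2 : ℝ) ∂joint.toMeasure) ^ (1 / 2 : ℝ) *
          (∫⁻ z, w (z.1, z.2.1) ^ (2 : ℝ) ∂joint.toMeasure) ^ (1 / 2 : ℝ) :=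
        ENNReal.lintegral_mul_le_Lp_mul_Lq _ Real.HolderConjugate.two_two
          (Measurable.of_discrete).aemeasurable (Measurable.of_discrete).aemeasurable
    _ = _ := by
        simp only [ENNReal.rpow_two]
        rw [concentrability, hjoint fun z => (π z.1 z.2 / πref z.1 z.2) ^ 2,
          hjoint fun z => w z ^ 2]

end PolicyStep

/-! ### The pessimistic cost -/

section Pessimism

variable {X Y : Type*}

theorem abs_expectedCost_le [MeasurableSpace Y] {q : X → Y → PMF Y} {Δ : Y → Y → ℝ} {M : ℝ}
    (hΔ : ∀ y y', 0 ≤ Δ y y' ∧ Δ y y' ≤ M) (z : X × Y) : |expectedCost q Δ z| ≤ M :=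
  abs_integral_le_of_abs_le _ fun y' => by rw [abs_of_nonneg (hΔ _ _).1]; exact (hΔ _ _).2

theorem finite_confidenceSet_image {n : ℕ} (F : Finset (X × Y → ℝ)) (r : ℝ) (D : Fin n → X × Y × Y)
    (fhat : X × Y → ℝ) (z : X × Y) :
    ((fun f : X × Y → ℝ => f z) '' confidenceSet F r D fhat).Finite :=
  (F.finite_toSet.subset fun _ hf => hf.1).image _

theorem le_pessimisticCost {n : ℕ} {F : Finset (X × Y → ℝ)} {r : ℝ} {D : Fin n → X × Y × Y}
    {fhat f : X × Y → ℝ} (hf : f ∈ confidenceSet F r D fhat) (z : X × Y) :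
    f z ≤ pessimisticCost F r D fhat z :=
  le_csSup (finite_confidenceSet_image F r D fhat z).bddAbove ⟨f, hf, rfl⟩

theorem exists_pessimisticCost_eq {n : ℕ} {F : Finset (X × Y → ℝ)} {r : ℝ} (hr : 0 ≤ r)
    {D : Fin n → X × Y × Y} {fhat : X × Y → ℝ} (hfhat : fhat ∈ F) (z : X × Y) :
    ∃ f ∈ confidenceSet F r D fhat, pessimisticCost F r D fhat z = f z := by
  have hne : ((fun f : X × Y → ℝ => f z) '' confidenceSet F r D fhat).Nonempty :=
    ⟨_, fhat, ⟨hfhat, by simpa using hr⟩, rfl⟩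
  obtain ⟨f, hf, h⟩ := hne.csSup_mem (finite_confidenceSet_image F r D fhat z)
  exact ⟨f, hf, h.symm⟩

variable [Countable X] [Countable Y] [MeasurableSpace X] [DiscreteMeasurableSpace X]
  [MeasurableSpace Y] [DiscreteMeasurableSpace Y]

/-- With high probability over the data, the pessimistic cost dominates the expected cost, and
exceeds it by at most a width whose second moment is controlled by the eluder dimension. -/
theorem offlineLaw_pessimism_le {n : ℕ} (hn : 2 ≤ n) {ρ : PMF X} {πref : Policy X Y}
    {q : X → Y → PMF Y} {Δ : Y → Y → ℝ} {M : ℝ} (hM : 0 < M)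
    (hΔ : ∀ y y', 0 ≤ Δ y y' ∧ Δ y y' ≤ M) {F : Finset (X × Y → ℝ)} (hF : ∀ f ∈ F, ∀ z, |f z| ≤ M)
    (hc : expectedCost q Δ ∈ F) {b L : ℝ} (hb : 8 ≤ b) (hL : 1 / 2 ≤ L)
    (hd : 1 ≤ (eluderDim (F : Set (X × Y → ℝ)) (M / n)).toNat)
    {fhat : (Fin n → X × Y × Y) → (X × Y → ℝ)} (hfhat : ∀ D, IsLeastSquares F Δ D (fhat D)) :
    offlineLaw n ρ πref q {D | ¬ ∃ W : X × Y → ℝ,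
      (∀ z, expectedCost q Δ z ≤ pessimisticCost F (b * M ^ 2 * L) D (fhat D) z) ∧
      (∀ z, pessimisticCost F (b * M ^ 2 * L) D (fhat D) z ≤ expectedCost q Δ z + W z) ∧
      ∫⁻ x, ∫⁻ y, ENNReal.ofReal (W (x, y)) ^ 2 ∂(πref x).toMeasure ∂ρ.toMeasure ≤
        ENNReal.ofReal (1000 * b * M ^ 2 *
          (Real.log n * (eluderDim (F : Set (X × Y → ℝ)) (M / n)).toNat * L / n))} ≤
      (3 * F.card + 1) * ENNReal.ofReal (Real.exp (-(4 * L))) := by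
  classical
  set c := expectedCost q Δ with hcdef
  set d : ℝ := ((eluderDim (F : Set (X × Y → ℝ)) (M / n)).toNat : ℝ) with hddef
  set μ := (editLaw ρ πref q).toMeasure
  have hn0 : (0 : ℝ) < n := by exact_mod_cast (by omega : 0 < n)
  have hd1 : 1 ≤ d := by rw [hddef]; exact_mod_cast hd
  have hlogn : 1 / 2 ≤ Real.log n := by
    have := Real.log_le_log (by norm_num) (by exact_mod_cast hn : (2 : ℝ) ≤ n)
    linarith [Real.log_two_gt_d9]
  have hsq : ∀ f ∈ F, ∀ z, (f z - c z) ^ 2 ≤ 4 * M ^ 2 := by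
    intro f hf z
    have h1 := abs_le.mp (hF f hf z)
    have h2 := abs_le.mp (hF c hc z)
    nlinarith
  set m : (X × Y → ℝ) → ℝ := fun f => ∫ z : X × Y × Y, (f (z.1, z.2.1) - c (z.1, z.2.1)) ^ 2 ∂μ
    with hm
  -- The radius comes from the confidence set: empirical squared distance to `c` at most `(2 b + 16)
  -- M² L`, doubled by the deviation bound with error `32 M² L`, gives `4 b + 64 ≤ 12 b`.
  set Fpop := F.filter fun f => n * m f ≤ 12 * b * M ^ 2 * L with hFpop
  have hcpop : c ∈ Fpop := by
    refine Finset.mem_filter.mpr ⟨hc, ?_⟩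
    simp only [hm, sub_self, ne_eq, OfNat.ofNat_ne_zero, not_false_eq_true, zero_pow,
      integral_zero, mul_zero]
    positivity
  -- Defined from population distances, `W` is independent of `D`, so event `A₄` needs no union
  -- bound.
  set W : X × Y → ℝ := fun z => Fpop.sup' ⟨c, hcpop⟩ fun f => |f z - c z| with hW
  have hWle : ∀ f ∈ Fpop, ∀ z, |f z - c z| ≤ W z := fun f hf z =>
    Finset.le_sup' (fun f => |f z - c z|) hf
  have hWex : ∀ z, ∃ f ∈ Fpop, W z = |f z - c z| := fun z => Finset.exists_mem_eq_sup' _ _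
  have hW0 : ∀ z, 0 ≤ W z := fun z => (abs_nonneg _).trans (hWle c hcpop z)
  have hW2 : ∀ z, W z ≤ 2 * M := by
    intro z
    obtain ⟨f, hf, h⟩ := hWex z
    rw [h]
    exact abs_le_of_sq_le_sq (by nlinarith [hsq f (Finset.mem_filter.mp hf).1 z]) (by positivity)
  have hWsq : ∀ z, W z ^ 2 ≤ 4 * M ^ 2 := fun z => by nlinarith [hW0 z, hW2 z]
  set A₁ : (X × Y → ℝ) → Set (Fin n → X × Y × Y) := fun f =>
    {D | squaredLoss Δ D f ≤ squaredLoss Δ D c ∧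
      2 * M ^ 2 * (4 * L) ≤ ∑ i, (f ((D i).1, (D i).2.1) - c ((D i).1, (D i).2.1)) ^ 2}
    with hA₁
  set A₂ : (X × Y → ℝ) → Set (Fin n → X × Y × Y) := fun f =>
    {D | 2 * ∑ i, (f ((D i).1, (D i).2.1) - c ((D i).1, (D i).2.1)) ^ 2 +
      2 * (4 * M ^ 2) * (4 * L) ≤ n * m f} with hA₂
  set A₃ : (X × Y → ℝ) → Set (Fin n → X × Y × Y) := fun f =>
    {D | 2 * (n * m f) + 4 * M ^ 2 * (4 * L) ≤
      ∑ i, (f ((D i).1, (D i).2.1) - c ((D i).1, (D i).2.1)) ^ 2} with hA₃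
  set A₄ : Set (Fin n → X × Y × Y) :=
    {D | 2 * ∑ i, W ((D i).1, (D i).2.1) ^ 2 + 2 * (4 * M ^ 2) * (4 * L) ≤
      n * ∫ z : X × Y × Y, W (z.1, z.2.1) ^ 2 ∂μ} with hA₄
  set e : ℝ≥0∞ := ENNReal.ofReal (Real.exp (-(4 * L)))
  have hM2 : 0 < M ^ 2 := by positivity
  have hML : 0 < M ^ 2 * L := by positivity
  have hbound : ∀ D, D ∉ (⋃ f ∈ F, (A₁ f ∪ A₂ f ∪ A₃ f)) ∪ A₄ →
      (∀ z, c z ≤ pessimisticCost F (b * M ^ 2 * L) D (fhat D) z) ∧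
      (∀ z, pessimisticCost F (b * M ^ 2 * L) D (fhat D) z ≤ c z + W z) ∧
      ∫⁻ x, ∫⁻ y, ENNReal.ofReal (W (x, y)) ^ 2 ∂(πref x).toMeasure ∂ρ.toMeasure ≤
        ENNReal.ofReal (1000 * b * M ^ 2 * (Real.log n * d * L / n)) := by
    intro D hD
    simp only [Set.mem_union, Set.mem_iUnion, not_or, not_exists] at hD
    obtain ⟨hA, h4⟩ := hD
    have h1 : ∀ f ∈ F, D ∉ A₁ f := fun f hf => (hA f hf).1.1
    have h2 : ∀ f ∈ F, D ∉ A₂ f := fun f hf => (hA f hf).1.2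
    have h3 : ∀ f ∈ F, D ∉ A₃ f := fun f hf => (hA f hf).2
    simp only [hA₁, hA₂, hA₃, hA₄, Set.mem_ofPred_eq, not_and, not_le] at h1 h2 h3 h4
    -- The least squares fit is within `8 M² L` of `c` on the data; hence `b ≥ 8` puts `c` in the
    -- confidence set.
    have hfc := h1 (fhat D) (hfhat D).1 ((hfhat D).2 c hc)
    have hcconf : c ∈ confidenceSet F (b * M ^ 2 * L) D (fhat D) := by
      refine ⟨hc, ?_⟩
      simp only [← neg_sub (fhat D _) (c _), neg_sq]
      nlinarith
    have hconf : ∀ f ∈ confidenceSet F (b * M ^ 2 * L) D (fhat D), f ∈ Fpop := by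
      intro f hf
      refine Finset.mem_filter.mpr ⟨hf.1, ?_⟩
      have h5 := h2 f hf.1
      have h6 : ∑ i, (f ((D i).1, (D i).2.1) - c ((D i).1, (D i).2.1)) ^ 2 ≤
          2 * ∑ i, (f ((D i).1, (D i).2.1) - fhat D ((D i).1, (D i).2.1)) ^ 2 +
          2 * ∑ i, (fhat D ((D i).1, (D i).2.1) - c ((D i).1, (D i).2.1)) ^ 2 := by
        rw [Finset.mul_sum, Finset.mul_sum, ← Finset.sum_add_distrib]
        refine Finset.sum_le_sum fun i _ => ?_
        nlinarith [sq_nonneg (f ((D i).1, (D i).2.1) - fhat D ((D i).1, (D i).2.1) -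
          (fhat D ((D i).1, (D i).2.1) - c ((D i).1, (D i).2.1)))]
      have h7 := hf.2
      have h8 : 8 * (M ^ 2 * L) ≤ b * (M ^ 2 * L) := by gcongr
      linarith
    have hr : 0 ≤ b * M ^ 2 * L := by positivity
    refine ⟨fun z => le_pessimisticCost hcconf z, fun z => ?_, ?_⟩
    · obtain ⟨f, hf, h⟩ := exists_pessimisticCost_eq (D := D) hr (hfhat D).1 z
      rw [h]
      linarith [(le_abs_self _).trans (hWle f (hconf f hf) z)]
    have h8 : 8 * (M ^ 2 * L) ≤ b * (M ^ 2 * L) := by gcongr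
    -- Back on the sample: members of `Fpop` have empirical distance at most `2 · 12 b + 16 ≤ 26 b`
    -- in units of `M² L`, by the complement of `A₃`.
    have hsum := sum_sq_width_le (F := F) (M := M) (R := 26 * b * M ^ 2 * L) hM (by positivity) hn
      (fun i => ((D i).1, (D i).2.1)) W hW0 hW2 (by
        intro u ε _ hε
        obtain ⟨f, hf, h⟩ := hWex u
        have hfF := (Finset.mem_filter.mp hf).1
        have h5 : ∑ i, (f ((D i).1, (D i).2.1) - c ((D i).1, (D i).2.1)) ^ 2 ≤
            26 * b * M ^ 2 * L := by
          linarith [h3 f hfF, (Finset.mem_filter.mp hf).2]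
        rw [h] at hε
        rcases lt_abs.mp hε with h6 | h6
        · exact ⟨f, hfF, c, hc, h5, h6⟩
        · refine ⟨c, hc, f, hfF, ?_, by linarith⟩
          simpa only [← neg_sub (f _) (c _), neg_sq] using h5)
    have hWmeas : ∫⁻ x, ∫⁻ y, ENNReal.ofReal (W (x, y)) ^ 2 ∂(πref x).toMeasure ∂ρ.toMeasure =
        ENNReal.ofReal (∫ z : X × Y × Y, W (z.1, z.2.1) ^ 2 ∂μ) := by
      rw [ofReal_integral_eq_lintegral_ofReal (Integrable.of_bound
        (Measurable.of_discrete).aestronglyMeasurable (4 * M ^ 2)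
        (Filter.Eventually.of_forall fun z => by
          rw [Real.norm_of_nonneg (sq_nonneg _)]; exact hWsq _))
        (Filter.Eventually.of_forall fun z => sq_nonneg _), lintegral_editLaw]
      simp [ENNReal.ofReal_pow (hW0 _)]
    rw [hWmeas]
    refine ENNReal.ofReal_le_ofReal ?_
    rw [← mul_div_assoc, le_div_iff₀ hn0, mul_comm]
    set Q := Real.log n * d
    have hQ : 1 / 2 ≤ Q := by
      have := mul_le_mul hlogn hd1 zero_le_one (by linarith)
      simpa using this
    have e1 : M ^ 2 * L ≤ 2 * (M ^ 2 * L * Q) := by nlinarith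
    have e2 : M ^ 2 ≤ 2 * (M ^ 2 * L) := by nlinarith
    have e3 : M ^ 2 * Q ≤ 2 * (M ^ 2 * L) * Q := by gcongr
    have e4 : 8 * (M ^ 2 * L * Q) ≤ b * (M ^ 2 * L * Q) := by gcongr
    have e5 : 1000 * b * M ^ 2 * (Q * L) = 1000 * (b * (M ^ 2 * L * Q)) := by ring
    have e6 : 16 * (26 * b * M ^ 2 * L + M ^ 2) * Q =
        416 * (b * (M ^ 2 * L * Q)) + 16 * (M ^ 2 * Q) := by ring
    rw [e5]
    rw [e6] at hsum
    nlinarith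
  have hmeas : offlineLaw n ρ πref q ((⋃ f ∈ F, (A₁ f ∪ A₂ f ∪ A₃ f)) ∪ A₄) ≤
      (3 * F.card + 1) * e := by
    calc _ ≤ ∑ f ∈ F, offlineLaw n ρ πref q (A₁ f ∪ A₂ f ∪ A₃ f) + offlineLaw n ρ πref q A₄ :=
          (measure_union_le _ _).trans (add_le_add_left (measure_biUnion_finset_le _ _) _)
      _ ≤ ∑ _f ∈ F, 3 * e + e := by
          refine add_le_add (Finset.sum_le_sum fun f hf => ?_) ?_
          · rw [show (3 : ℝ≥0∞) * e = e + e + e by ring]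
            refine (measure_union_le _ _).trans (add_le_add ((measure_union_le _ _).trans
              (add_le_add ?_ ?_)) ?_)
            · exact offlineLaw_squaredLoss_le (by omega) hM hΔ (hF f hf) _
            · exact pi_lower_deviation_le (φ := fun z : X × Y × Y =>
                (f (z.1, z.2.1) - c (z.1, z.2.1)) ^ 2) (Measurable.of_discrete) (by positivity)
                (fun z => sq_nonneg _) (fun z => hsq f hf _) _
            · exact pi_upper_deviation_le (φ := fun z : X × Y × Y =>
                (f (z.1, z.2.1) - c (z.1, z.2.1)) ^ 2) (Measurable.of_discrete) (by positivity)
                (fun z => sq_nonneg _) (fun z => hsq f hf _) _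
          · exact pi_lower_deviation_le (φ := fun z : X × Y × Y => W (z.1, z.2.1) ^ 2)
              (Measurable.of_discrete) (by positivity) (fun z => sq_nonneg _) (fun z => hWsq _) _
      _ = _ := by
          rw [Finset.sum_const, nsmul_eq_mul]
          ring
  refine (measure_mono fun D hD => ?_).trans hmeas
  by_contra hcon
  exact hD ⟨W, hbound D hcon⟩

end Pessimism

/-! ### Assembling the guarantee -/

/-- Fubini over the first coordinate: the bad set `T` is charged 1 per slice, the rest `b`. -/
theorem prod_apply_le_add {A B : Type*} [MeasurableSpace A] [MeasurableSpace B]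
    [DiscreteMeasurableSpace A] [DiscreteMeasurableSpace (A × B)] (μ : Measure A) (ν : Measure B)
    [IsProbabilityMeasure μ] [IsProbabilityMeasure ν] {T : Set A} {S : Set (A × B)} {a b : ℝ≥0∞}
    (hT : μ T ≤ a) (hS : ∀ᵐ u ∂μ, u ∉ T → ν {v | (u, v) ∈ S} ≤ b) : μ.prod ν S ≤ a + b := by
  rw [Measure.prod_apply (MeasurableSet.of_discrete)]
  calc ∫⁻ u, ν (Prod.mk u ⁻¹' S) ∂μ ≤ ∫⁻ u, (T.indicator 1 u + b) ∂μ := by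
        refine lintegral_mono_ae ?_
        filter_upwards [hS] with u hu
        by_cases huT : u ∈ T
        · rw [Set.indicator_of_mem huT]
          exact prob_le_one.trans le_self_add
        · exact (hu huT).trans le_add_self
    _ = μ T + b := by
        rw [lintegral_add_right _ measurable_const, lintegral_indicator_one
          (MeasurableSet.of_discrete)]
        simp
    _ ≤ a + b := by gcongr

/-- Since `δ / N ≤ 1 / 2`, three of the four factors of `(δ / N) ^ 4` yield the `1 / 8` that pays
for the constants of the union bounds. -/
theorem exp_neg_four_mul_log_div_le {N : ℕ} (hN : 2 ≤ N) {δ : ℝ} (h0 : 0 < δ) (h1 : δ < 1) :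
    Real.exp (-(4 * Real.log (N / δ))) ≤ δ / (8 * N) := by
  have hN2 : (2 : ℝ) ≤ N := by exact_mod_cast hN
  have hNpos : (0 : ℝ) < N := by linarith
  have e : Real.exp (-(4 * Real.log (N / δ))) = (δ / N) ^ 4 := by
    rw [Real.exp_neg, show (4 : ℝ) * Real.log (N / δ) = ((4 : ℕ) : ℝ) * Real.log (N / δ) by norm_num,
      Real.exp_nat_mul, Real.exp_log (by positivity), ← inv_pow, inv_div]
  have h2 : δ / N ≤ 1 / 2 := by
    rw [div_le_iff₀ hNpos]
    linarith
  rw [e]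
  calc (δ / N) ^ 4 = (δ / N) ^ 3 * (δ / N) := by ring
    _ ≤ (1 / 2) ^ 3 * (δ / N) := by gcongr
    _ = δ / (8 * N) := by ring

theorem half_le_log_div {N : ℕ} (hN : 2 ≤ N) {δ : ℝ} (h0 : 0 < δ) (h1 : δ < 1) :
    1 / 2 ≤ Real.log (N / δ) := by
  have hN2 : (2 : ℝ) ≤ N := by exact_mod_cast hN
  have h2 : (2 : ℝ) ≤ N / δ := by
    rw [le_div_iff₀ h0]
    linarith
  linarith [Real.log_le_log (by norm_num) h2, Real.log_two_gt_d9]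

/-- The square root of `ofReal x`. -/
theorem ofReal_rpow_half {x : ℝ} (hx : 0 ≤ x) :
    ENNReal.ofReal x ^ (1 / 2 : ℝ) = ENNReal.ofReal √x := by
  rw [ENNReal.ofReal_rpow_of_nonneg hx (by norm_num), Real.sqrt_eq_rpow]

section Assembly

variable {X Y : Type*} [MeasurableSpace Y] [DiscreteMeasurableSpace Y]
  [MeasurableSpace X] [DiscreteMeasurableSpace X]

/-- The regret of a nearly optimal policy for a surrogate cost `g` with `c - a ≤ g ≤ c + w`. -/
theorem regObjective_le_add_width {ρ : PMF X} {πref : Policy X Y} {β M : ℝ} {c g : X × Y → ℝ}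
    (hc : ∀ z, |c z| ≤ M) (hg : ∀ z, |g z| ≤ M) {a : ℝ} (w : X × Y → ℝ)
    (hcg : ∀ z, c z ≤ g z + a) (hgc : ∀ z, g z ≤ c z + w z) {π₀ π πstar : Policy X Y}
    (hopt : IsRegOptimal ρ πref β g π₀) {η : ℝ≥0∞}
    (hπ : ∫⁻ u, shiftedCostAt πref β M g π u ∂ρ.toMeasure ≤
      ∫⁻ u, shiftedCostAt πref β M g π₀ u ∂ρ.toMeasure + η) :
    regObjective ρ πref β c π ≤ regObjective ρ πref β c πstar +
      ((∫⁻ x, ∫⁻ y, ENNReal.ofReal (w (x, y)) ∂(πstar x).toMeasure ∂ρ.toMeasure + η +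
        ENNReal.ofReal a : ℝ≥0∞) : EReal) := by
  rw [regObjective_le_iff hc]
  calc _ ≤ ∫⁻ u, shiftedCostAt πref β M g π u ∂ρ.toMeasure + ENNReal.ofReal a :=
        lintegral_shiftedCostAt_le_add_const hcg π
    _ ≤ ∫⁻ u, shiftedCostAt πref β M g π₀ u ∂ρ.toMeasure + η + ENNReal.ofReal a := by gcongr
    _ ≤ ∫⁻ u, shiftedCostAt πref β M g πstar u ∂ρ.toMeasure + η + ENNReal.ofReal a := by
        exact add_le_add_left (add_le_add_left (hopt.lintegral_le hg πstar) _) _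
    _ ≤ (∫⁻ u, shiftedCostAt πref β M c πstar u ∂ρ.toMeasure +
          ∫⁻ x, ∫⁻ y, ENNReal.ofReal (w (x, y)) ∂(πstar x).toMeasure ∂ρ.toMeasure) + η +
          ENNReal.ofReal a := by
        gcongr
        exact lintegral_shiftedCostAt_le_add_lintegral w hgc πstar
    _ = _ := by ring

theorem sqrt_policy_deviation_le {n : ℕ} (hn : 0 < n) {M l : ℝ} (hM : 0 < M) :
    4 * M * √(n * (4 * l) / 2) / n ≤ 6 * M * √(l / n) := by
  have hn0 : (0 : ℝ) < n := by exact_mod_cast hn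
  have e : (n : ℝ) * (4 * l) / 2 = n ^ 2 * (2 * (l / n)) := by
    field_simp
    ring
  rw [e, Real.sqrt_mul (by positivity), Real.sqrt_sq hn0.le, Real.sqrt_mul (by norm_num)]
  have h2 : √2 ≤ 3 / 2 := Real.sqrt_le_iff.mpr ⟨by norm_num, by norm_num⟩
  calc 4 * M * (n * (√2 * √(l / n))) / n = 4 * M * √(l / n) * √2 := by field_simp
    _ ≤ 4 * M * √(l / n) * (3 / 2) := by gcongr
    _ = _ := by ring

/-- Absorbs errors of order `M / n` into the policy term when the eluder term may vanish. -/
theorem div_le_sqrt_log_div {n : ℕ} (hn : 0 < n) {M l : ℝ} (hM : 0 < M) (hl : 1 / 2 ≤ l) :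
    2 * M / n ≤ 3 * M * √(l / n) := by
  have hn0 : (1 : ℝ) ≤ n := by exact_mod_cast hn
  have h : 2 / (3 * n) ≤ √(l / n) := by
    refine Real.le_sqrt_of_sq_le ?_
    rw [div_pow, div_le_div_iff₀ (by positivity) (by positivity)]
    nlinarith [mul_le_mul hl hn0 zero_le_one (by linarith)]
  calc 2 * M / n = 3 * M * (2 / (3 * n)) := by field_simp
    _ ≤ _ := by gcongr

end Assembly

end UserEdits

end

/-! ### The main theorem -/

open UserEdits in
theorem mainTheorem3 :
    ∃ b₀ : ℝ, 1 ≤ b₀ ∧ ∀ b : ℝ, b₀ ≤ b → ∃ K : ℝ, 0 < K ∧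
      ∀ (X : Type*) (Y : Type*) [Countable X] [Countable Y]
        [MeasurableSpace X] [DiscreteMeasurableSpace X]
        [MeasurableSpace Y] [DiscreteMeasurableSpace Y]
        (n : ℕ) (_ : 1 ≤ n) (δ : ℝ) (_ : 0 < δ) (_ : δ < 1)
        (β : ℝ) (_ : 0 < β) (cmax : ℝ) (_ : 0 < cmax)
        (ρ : PMF X) (πref : UserEdits.Policy X Y) (q : X → Y → PMF Y)
        (Δ : Y → Y → ℝ) (_ : ∀ y y', 0 ≤ Δ y y' ∧ Δ y y' ≤ cmax)
        (F : Finset (X × Y → ℝ)) (_ : ∀ f ∈ F, ∀ z, |f z| ≤ cmax)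
        (_ : UserEdits.expectedCost q Δ ∈ F)
        (P : Finset (UserEdits.Policy X Y))
        (πstar : UserEdits.Policy X Y) (_ : πstar ∈ P)
        (_ : UserEdits.IsRegOptimal ρ πref β (UserEdits.expectedCost q Δ) πstar)
        (fhat : (Fin n → X × Y × Y) → (X × Y → ℝ))
        (_ : ∀ D, UserEdits.IsLeastSquares F Δ D (fhat D))
        (fbar : (Fin n → X × Y × Y) → (X × Y → ℝ))
        (_ : ∀ D, fbar D = UserEdits.pessimisticCost F
          (b * cmax ^ 2 * Real.log (F.card / δ)) D (fhat D))
        (_ : ∀ᵐ D ∂(UserEdits.offlineLaw n ρ πref q),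
          ∃ π ∈ P, UserEdits.IsRegOptimal ρ πref β (fbar D) π),
        ENNReal.ofReal (1 - δ) ≤ UserEdits.sampleLaw n ρ πref q
          {s | ∀ πhat : UserEdits.Policy X Y,
            UserEdits.IsRLPolicy ρ πref β cmax P (fbar s.1) s.2 πhat →
              UserEdits.regObjective ρ πref β (UserEdits.expectedCost q Δ) πhat ≤
                UserEdits.regObjective ρ πref β (UserEdits.expectedCost q Δ) πstar +
                ((ENNReal.ofReal (K * cmax) *
                  (ENNReal.ofReal √(Real.log (P.card / δ) / n) +
                    UserEdits.concentrability ρ πref πstar *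
                      ENNReal.ofReal √(Real.log n *
                        (UserEdits.eluderDim (F : Set (X × Y → ℝ)) (cmax / n)).toNat *
                        Real.log (F.card / δ) / n)) : ℝ≥0∞) : EReal)} := by

  refine ⟨8, by norm_num, fun b hb => ⟨1000 * b, by positivity, ?_⟩⟩
  intro X Y _ _ _ _ _ _ n hn δ hδ0 hδ1 β hβ M hM ρ πref q Δ hΔ F hF hc P πstar hstar hopt fhat hfhat
    fbar hfbar hae
  set c := expectedCost q Δ with hcdef
  have hcM : ∀ z, |c z| ≤ M := abs_expectedCost_le hΔ
  have : IsProbabilityMeasure (offlineLaw n ρ πref q) := by unfold offlineLaw; infer_instance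
  have : IsProbabilityMeasure (sampleLaw n ρ πref q) := by unfold sampleLaw; infer_instance
  set T : ℝ≥0∞ := ENNReal.ofReal (1000 * b * M) *
    (ENNReal.ofReal √(Real.log (P.card / δ) / n) + concentrability ρ πref πstar *
      ENNReal.ofReal √(Real.log n * (eluderDim (F : Set (X × Y → ℝ)) (M / n)).toNat *
        Real.log (F.card / δ) / n)) with hT
  -- With a single policy, `log (|P| / δ)` may be arbitrarily small, but then `πhat` is `πstar`.
  rcases le_or_gt P.card 1 with hP | hP
  · have huniv : {s : (Fin n → X × Y × Y) × (Fin n → X) | ∀ πhat : Policy X Y,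
        IsRLPolicy ρ πref β M P (fbar s.1) s.2 πhat →
          regObjective ρ πref β c πhat ≤ regObjective ρ πref β c πstar + (T : EReal)} =
        Set.univ := by
      refine Set.eq_univ_of_forall fun s πhat h => ?_
      rw [Finset.card_le_one.mp hP πhat h.1.1 πstar hstar]
      exact le_add_of_nonneg_right (EReal.coe_ennreal_nonneg _)
    rw [huniv, measure_univ]
    exact ENNReal.ofReal_le_one.mpr (by linarith)
  have hlP := half_le_log_div hP hδ0 hδ1
  have hn0 : (0 : ℝ) < n := by exact_mod_cast hn
  have hr : 0 ≤ b * M ^ 2 * Real.log (F.card / δ) := by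
    have : (1 : ℝ) ≤ F.card := by exact_mod_cast Finset.card_pos.mpr ⟨c, hc⟩
    have : 0 ≤ Real.log (F.card / δ) := Real.log_nonneg (by rw [le_div_iff₀ hδ0]; linarith)
    positivity
  have hex : ∀ D z, ∃ f ∈ F, fbar D z = f z := by
    intro D z
    obtain ⟨f, hf, h⟩ := exists_pessimisticCost_eq (D := D) hr (hfhat D).1 z
    exact ⟨f, hf.1, by rw [hfbar, h]⟩
  have hfbarM : ∀ D z, |fbar D z| ≤ M := fun D z => by
    obtain ⟨f, hf, h⟩ := hex D z
    rw [h]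
    exact hF f hf z
  set η : ℝ≥0∞ := ENNReal.ofReal (4 * M * √(n * (4 * Real.log (P.card / δ)) / 2) / n) with hη
  have hηle : η ≤ ENNReal.ofReal (6 * M * √(Real.log (P.card / δ) / n)) :=
    ENNReal.ofReal_le_ofReal (sqrt_policy_deviation_le hn hM)
  -- `A` is the failure event of the data alone. Outside it, near optimality for `fbar` already
  -- implies the final bound, whatever the contexts.
  obtain ⟨A, hA, hdet⟩ : ∃ A : Set (Fin n → X × Y × Y),
      offlineLaw n ρ πref q A ≤ ENNReal.ofReal (δ / 2) ∧ ∀ D ∉ A, ∀ π₀,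
        IsRegOptimal ρ πref β (fbar D) π₀ → ∀ π,
          ∫⁻ u, shiftedCostAt πref β M (fbar D) π u ∂ρ.toMeasure ≤
            ∫⁻ u, shiftedCostAt πref β M (fbar D) π₀ u ∂ρ.toMeasure + η →
          regObjective ρ πref β c π ≤ regObjective ρ πref β c πstar + (T : EReal) := by
    -- Here `log n`, `log (|F| / δ)` or the dimension may be zero or too small for the pessimism
    -- bound. All functions of `F` are then within `2 M / n` of each other, and no event need be
    -- excluded.
    by_cases hcase : n = 1 ∨ F.card ≤ 1 ∨ (eluderDim (F : Set (X × Y → ℝ)) (M / n)).toNat = 0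
    · have hclose : ∀ f ∈ F, ∀ g ∈ F, ∀ z, f z ≤ g z + 2 * M / n := by
        intro f hf g hg z
        rcases hcase with rfl | hcard | hd
        · have h1 := abs_le.mp (hF f hf z)
          have h2 := abs_le.mp (hF g hg z)
          norm_num
          linarith
        · rw [Finset.card_le_one.mp hcard f hf g hg]
          have : 0 ≤ 2 * M / n := by positivity
          linarith
        · have h1 := sub_le_of_eluderDim_eq_zero (by positivity) hd hf hg z
          have h2 : M / n ≤ 2 * M / n := by gcongr; linarith
          linarith
      refine ⟨∅, by simp, fun D _ π₀ h₀ π hπ => ?_⟩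
      refine (regObjective_le_add_width (a := 2 * M / n) hcM (hfbarM D) (fun _ => 2 * M / n)
        (fun z => ?_) (fun z => ?_) h₀ hπ (πstar := πstar)).trans ?_
      · obtain ⟨f, hf, h⟩ := hex D z
        rw [h]
        exact hclose c hc f hf z
      · obtain ⟨f, hf, h⟩ := hex D z
        rw [h]
        exact hclose f hf c hc z
      · refine add_le_add_right (EReal.coe_ennreal_le_coe_ennreal_iff.mpr ?_) _
        simp only [lintegral_const, measure_univ, mul_one]
        have h1 := ENNReal.ofReal_le_ofReal (div_le_sqrt_log_div hn hM hlP)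
        calc _ ≤ ENNReal.ofReal (3 * M * √(Real.log (P.card / δ) / n)) +
              ENNReal.ofReal (6 * M * √(Real.log (P.card / δ) / n)) +
              ENNReal.ofReal (3 * M * √(Real.log (P.card / δ) / n)) := by gcongr
          _ = ENNReal.ofReal (12 * M) * ENNReal.ofReal √(Real.log (P.card / δ) / n) := by
              rw [← ENNReal.ofReal_add (by positivity) (by positivity),
                ← ENNReal.ofReal_add (by positivity) (by positivity),
                ← ENNReal.ofReal_mul (by positivity)]
              congr 1
              ring
          _ ≤ T := by
              rw [hT]
              gcongr
              · linarith
              · exact le_self_add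
    · push Not at hcase
      obtain ⟨hn1, hFcard, hd⟩ := hcase
      have hL := half_le_log_div hFcard hδ0 hδ1
      have hpess := offlineLaw_pessimism_le (n := n) (by omega) (ρ := ρ) (πref := πref) hM hΔ hF hc
        hb hL (by omega) hfhat
      refine ⟨_, hpess.trans ?_, fun D hD π₀ h₀ π hπ => ?_⟩
      · have hN : (2 : ℝ) ≤ F.card := by exact_mod_cast hFcard
        calc (3 * (F.card : ℝ≥0∞) + 1) * ENNReal.ofReal (Real.exp (-(4 * Real.log (F.card / δ))))
            ≤ ENNReal.ofReal (3 * F.card + 1) * ENNReal.ofReal (δ / (8 * F.card)) := by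
              gcongr
              · rw [ENNReal.ofReal_add (by positivity) zero_le_one,
                  ENNReal.ofReal_mul (by norm_num)]
                simp
              · exact exp_neg_four_mul_log_div_le hFcard hδ0 hδ1
          _ = ENNReal.ofReal ((3 * F.card + 1) * (δ / (8 * F.card))) :=
              (ENNReal.ofReal_mul (by positivity)).symm
          _ ≤ ENNReal.ofReal (δ / 2) := by
              refine ENNReal.ofReal_le_ofReal ?_
              rw [← mul_div_assoc, div_le_div_iff₀ (by positivity) (by norm_num)]
              nlinarith
      · obtain ⟨W, hW1, hW2, hW3⟩ := not_not.mp hD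
        rw [← hfbar] at hW1 hW2
        refine (regObjective_le_add_width (a := 0) hcM (hfbarM D) W
          (fun z => by simpa using hW1 z) hW2 h₀ hπ (πstar := πstar)).trans ?_
        refine add_le_add_right (EReal.coe_ennreal_le_coe_ennreal_iff.mpr ?_) _
        have h1 := hopt.lintegral_le_concentrability_mul hβ hcM fun z => ENNReal.ofReal (W z)
        set v : ℝ := Real.log n * (eluderDim (F : Set (X × Y → ℝ)) (M / n)).toNat *
          Real.log (F.card / δ) / n
        have hv : 0 ≤ v := by
          have : 0 ≤ Real.log n := Real.log_natCast_nonneg n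
          positivity
        have h2 : (∫⁻ x, ∫⁻ y, ENNReal.ofReal (W (x, y)) ^ 2 ∂(πref x).toMeasure ∂ρ.toMeasure) ^
            (1 / 2 : ℝ) ≤ ENNReal.ofReal (1000 * b * M) * ENNReal.ofReal √v := by
          refine (ENNReal.rpow_le_rpow hW3 (by norm_num)).trans ?_
          rw [ofReal_rpow_half (by positivity), ← ENNReal.ofReal_mul (by positivity)]
          refine ENNReal.ofReal_le_ofReal ?_
          rw [Real.sqrt_mul (by positivity)]
          gcongr
          refine Real.sqrt_le_iff.mpr ⟨by positivity, ?_⟩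
          -- The square root of `1000 b` is replaced by `1000 b`, the `K` chosen at the start.
          have : 1000 * b * M ^ 2 * 1 ≤ 1000 * b * M ^ 2 * (1000 * b) := by gcongr; linarith
          linarith
        calc _ ≤ concentrability ρ πref πstar *
              (ENNReal.ofReal (1000 * b * M) * ENNReal.ofReal √v) +
              ENNReal.ofReal (6 * M * √(Real.log (P.card / δ) / n)) + ENNReal.ofReal 0 := by
              gcongr
              exact h1.trans (by gcongr)
          _ ≤ concentrability ρ πref πstar *
              (ENNReal.ofReal (1000 * b * M) * ENNReal.ofReal √v) +
              ENNReal.ofReal (1000 * b * M) * ENNReal.ofReal √(Real.log (P.card / δ) / n) := by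
              rw [ENNReal.ofReal_zero, add_zero]
              refine add_le_add_right ?_ _
              rw [← ENNReal.ofReal_mul (by positivity)]
              gcongr
              linarith
          _ = T := by rw [hT]; ring
  have hbad : sampleLaw n ρ πref q {s | ∀ πhat : Policy X Y,
      IsRLPolicy ρ πref β M P (fbar s.1) s.2 πhat →
        regObjective ρ πref β c πhat ≤ regObjective ρ πref β c πstar + (T : EReal)}ᶜ ≤
      ENNReal.ofReal (δ / 2) + ENNReal.ofReal (δ / 2) := by
    -- For fixed `D ∉ A`, `fbar D` is a fixed cost and only the fresh contexts are random; each
    -- stage gets `δ / 2`.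
    refine prod_apply_le_add _ _ hA ?_
    filter_upwards [hae] with D hD hDA
    obtain ⟨π₀, hπ₀, h₀⟩ := hD
    refine le_trans (measure_mono ?_) ((pi_isRLPolicy_le hn hM (hfbarM D) hπ₀ h₀
      (t := 4 * Real.log (P.card / δ)) (by linarith)).trans ?_)
    · intro x hx hgood
      refine hx fun πhat h => ?_
      exact hdet D hDA π₀ h₀ πhat (hgood πhat h)
    · have hN : (2 : ℝ) ≤ P.card := by exact_mod_cast hP
      calc (P.card : ℝ≥0∞) * (2 * ENNReal.ofReal (Real.exp (-(4 * Real.log (P.card / δ)))))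
          ≤ ENNReal.ofReal P.card * (ENNReal.ofReal 2 * ENNReal.ofReal (δ / (8 * P.card))) := by
            rw [ENNReal.ofReal_natCast, ENNReal.ofReal_ofNat]
            gcongr
            exact exp_neg_four_mul_log_div_le hP hδ0 hδ1
        _ = ENNReal.ofReal (δ / 4) := by
            rw [← ENNReal.ofReal_mul (by norm_num), ← ENNReal.ofReal_mul (by positivity)]
            congr 1
            field_simp
            norm_num
        _ ≤ ENNReal.ofReal (δ / 2) := ENNReal.ofReal_le_ofReal (by linarith)
  rw [← ENNReal.ofReal_add (by positivity) (by positivity), add_halves,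
    prob_compl_eq_one_sub (MeasurableSet.of_discrete), tsub_le_iff_right] at hbad
  rw [ENNReal.ofReal_sub _ hδ0.le, ENNReal.ofReal_one, tsub_le_iff_left]
  exact hbad
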